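/- **Setting.** Let $\mathcal E$ be an elementary topos with chosen finite products, $\Omega$ its subobject classifier and $PA=\Omega^A$ the power objects. Let $(\Sigma,E)$ be (a presentation of) a finitary algebraic variety, i.e. a single-sorted signature $\Sigma$ of operation symbols with finite arities and a set $E$ of equations between terms. A $(\Sigma,E)$-algebra is an algebra internal to $\mathcal E$: an object $A$ with morphisms $\sigma_A:A^n\to A$ for every $n$-ary $\sigma\in\Sigma$, satisfying $E$. Let $(Q,\otimes,k,\bigvee)$ be an internal commutative quantale of $\mathcal E$: an internal commutative monoid $(Q,\otimes,k)$ with an internal partial order $\le$ and a morphism $\bigvee:PQ\to Q$ giving the joins of arbitrary subsets, such that $a\otimes\bigvee S=\bigvee\{a\otimes s\mid s\in S\}$. Formulas with elements below are read in the internal language of $\mathcal E$; in particular, existential quantifiers hold locally, i.e. after restriction along an epimorphism. **Relations.** $\mathbf{Rel}_{(\Sigma,E)}(Q)$ has $(\Sigma,E)$-algebras as objects. A morphism $A\to B$ is an algebraic $Q$-relation, i.e. a morphism $R:A\times B\to Q$ of $\mathcal E$ with $$R(a_1,b_1)\otimes\dots\otimes R(a_n,b_n)\le R(\sigma(a_1,\dots,a_n),\sigma(b_1,\dots,b_n))$$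 for every $n$-ary $\sigma\in\Sigma$. Composition is $(S\circ R)(a,c)=\bigvee\{R(a,b)\otimes S(b,c)\mid b\in B\}$. The graph of a homomorphism $f:A\to B$ is $f_\circ(a,b)=\bigvee\{k\mid f(a)=b\}$, and the identity on $A$ is the graph of $1_A$. Tensor products are given by products of algebras and $(R\otimes R')((a,a'),(b,b'))=R(a,b)\otimes R'(a',b')$; the unit is the terminal algebra, and the coherence isomorphisms and the symmetry are the graphs of those of the finite products of $\mathcal E$. Relations are ordered by $R\subseteq R'$ iff $R(a,b)\le R'(a,b)$ for all $a,b$. **Spans.** $\mathbf{Span}_{(\Sigma,E)}(Q)$ has $(\Sigma,E)$-algebras as objects. A morphism $A\to B$ is an isomorphism class of algebraic $Q$-spans, i.e. of quadruples $(X,f,g,\chi)$ with $f:X\to A$, $g:X\to B$, $\chi:X\to Q$ morphisms of $\mathcal E$, such that for every $n$-ary $\sigma\in\Sigma$ and all $x_1,\dots,x_n$ in $X$ there exists $x$ in $X$ with $$f(x)=\sigma(f(x_1),\dots,f(x_n)),\quad g(x)=\sigma(g(x_1),\dots,g(x_n)),\quad \chi(x_1)\otimes\dots\otimes\chi(x_n)\le\chi(x);$$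 an isomorphism of $Q$-spans is an isomorphism of apices commuting with both legs and with the characteristic morphisms. Composition is by pullback: the composite of $(X,f,g,\chi):A\to B$ and $(Y,h,l,\xi):B\to C$ is $X\times_BY$ with its legs to $A$ and $C$ and characteristic morphism $(x,y)\mapsto\chi(x)\otimes\xi(y)$. The graph of a homomorphism $f:A\to B$ is $(A,1,f,\chi_k)$ with $\chi_k$ constantly $k$, and the identity on $A$ is $(A,1,1,\chi_k)$. The tensor product of $(X,f,g,\chi)$ and $(X',f',g',\chi')$ is $(X\times X',f\times f',g\times g',(x,x')\mapsto\chi(x)\otimes\chi'(x'))$, on objects it is the product of algebras, and the unit, the coherence isomorphisms and the symmetry are as for relations, with graphs in the sense of spans. Spans are preordered by $(X_1,f_1,g_1,\chi_1)\subseteq(X_2,f_2,g_2,\chi_2)$ iff there is a monomorphism $m:X_1\to X_2$ of $\mathcal E$ with $f_1=f_2\circ m$, $g_1=g_2\circ m$ and $\chi_1(x)\le\chi_2(m(x))$ for all $x$. Both are symmetric monoidal categories enriched in preorders (composition and tensor product are monotone). **Theorem.** There is an identity-on-objects, strict symmetric monoidal, $\mathbf{Preord}$-enriched functor (that is, one which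 is monotone on morphisms) $$V:\mathbf{Span}_{(\Sigma,E)}(Q)\longrightarrow\mathbf{Rel}_{(\Sigma,E)}(Q),$$ which sends the class of an algebraic $Q$-span $(X,f,g,\chi):A\to B$ to the algebraic $Q$-relation $$V(X,f,g,\chi)(a,b)=\bigvee\{\chi(x)\mid x\in X,\ f(x)=a,\ g(x)=b\}.$$ -/

import Mathlib

set_option linter.unusedSectionVars false

open CategoryTheory Limits MonoidalCategory CartesianMonoidalCategory

universe w v u

noncomputable section

namespace QuantaleTopos

section Topos

variable {E : Type u} [Category.{v} E] [CartesianMonoidalCategory E] [HasFiniteLimits E]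
  [MonoidalClosed E] [HasSubobjectClassifier E]

/-- The truth value `true`, at stage `I`. -/
def tru (I : E) : I ⟶ HasSubobjectClassifier.Ω E :=
  Subobject.Classifier.χ₀ _ I ≫ HasSubobjectClassifier.truth E

theorem comp_tru {I J : E} (g : J ⟶ I) : g ≫ tru I = tru J := by
  unfold tru
  rw [← Category.assoc]
  congr 1
  exact Subsingleton.elim _ _

theorem factors_iff_chi {U A I : E} (m : U ⟶ A) [Mono m] (x : I ⟶ A) :
    (∃ y : I ⟶ U, y ≫ m = x) ↔ x ≫ HasSubobjectClassifier.χ m = tru I := by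
  constructor
  · rintro ⟨y, rfl⟩
    rw [Category.assoc, HasSubobjectClassifier.comm]
    exact comp_tru y
  · intro h
    exact ⟨(HasSubobjectClassifier.isPullback_χ m).lift x _ h,
      (HasSubobjectClassifier.isPullback_χ m).lift_fst _ _ _⟩

theorem omega_ext {A : E} {p q : A ⟶ HasSubobjectClassifier.Ω E}
    (h : ∀ (I : E) (x : I ⟶ A), x ≫ p = tru I ↔ x ≫ q = tru I) : p = q := by
  let m := pullback.fst p (HasSubobjectClassifier.truth E)
  have hm : m ≫ p = tru _ := by
    rw [pullback.condition]; unfold tru; congr 1; exact Subsingleton.elim _ _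
  have hp : p = HasSubobjectClassifier.χ m := by
    apply HasSubobjectClassifier.unique
    convert IsPullback.of_hasPullback p (HasSubobjectClassifier.truth E)
    exact Subsingleton.elim _ _
  have hq : q = HasSubobjectClassifier.χ m := by
    apply HasSubobjectClassifier.unique
    refine ⟨⟨(h _ m).1 hm⟩, ⟨PullbackCone.IsLimit.mk _
      (fun s => pullback.lift s.fst s.snd ?_) ?_ ?_ ?_⟩⟩
    · have : s.fst ≫ q = tru _ := by
        rw [s.condition]; unfold tru; congr 1; exact Subsingleton.elim _ _
      rw [(h _ _).2 this]; unfold tru; congr 1; exact Subsingleton.elim _ _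
    · intro s; exact pullback.lift_fst _ _ _
    · intro s; exact Subsingleton.elim _ _
    · intro s k h1 h2
      rw [← cancel_mono m, h1]; exact (pullback.lift_fst _ _ _).symm
  rw [hp, hq]

/-- The power object `P A = Ω ^ A`. -/
abbrev Pow (A : E) : E := (ihom A).obj (HasSubobjectClassifier.Ω E)

/-- The membership predicate on `A × P A`. -/
def memMap (A : E) : A ⊗ Pow A ⟶ HasSubobjectClassifier.Ω E :=
  (ihom.ev A).app (HasSubobjectClassifier.Ω E)

/-- `a ∈ P`, for generalized elements `a` of `A` and `P` of `P A` at the same stage. -/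
def Mem {A I : E} (a : I ⟶ A) (P : I ⟶ Pow A) : Prop := lift a P ≫ memMap A = tru I

theorem curry_memMap {A I : E} (c : A ⊗ I ⟶ HasSubobjectClassifier.Ω E) :
    A ◁ MonoidalClosed.curry c ≫ memMap A = c :=
  MonoidalClosed.whiskerLeft_curry_ihom_ev_app _ _ c

theorem lift_curry_memMap {A I J : E} (a : J ⟶ A) (g : J ⟶ I)
    (c : A ⊗ I ⟶ HasSubobjectClassifier.Ω E) :
    lift a (g ≫ MonoidalClosed.curry c) ≫ memMap A = lift a g ≫ c := by
  conv_rhs => rw [← curry_memMap c]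
  rw [lift_whiskerLeft_assoc]

theorem pre_memMap {X Y I : E} (f : X ⟶ Y) (a : I ⟶ X) (P : I ⟶ Pow Y) :
    lift a (P ≫ (MonoidalClosed.pre f).app (HasSubobjectClassifier.Ω E)) ≫ memMap X =
      lift (a ≫ f) P ≫ memMap Y := by
  have h : X ◁ (MonoidalClosed.pre f).app (HasSubobjectClassifier.Ω E) ≫ memMap X =
    f ▷ _ ≫ memMap Y := MonoidalClosed.id_tensor_pre_app_comp_ev f _
  rw [← lift_whiskerLeft_assoc, h, lift_whiskerRight_assoc]

theorem pow_ext {A I : E} {P P' : I ⟶ Pow A}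
    (h : ∀ (J : E) (g : J ⟶ I) (a : J ⟶ A), lift a (g ≫ P) ≫ memMap A = lift a (g ≫ P') ≫ memMap A) :
    P = P' := by
  have h1 := h _ (snd A I) (fst A I)
  rw [← MonoidalClosed.curry_uncurry P, ← MonoidalClosed.curry_uncurry P', lift_curry_memMap,
    lift_curry_memMap, lift_fst_snd, Category.id_comp, Category.id_comp] at h1
  rw [← MonoidalClosed.curry_uncurry P, ← MonoidalClosed.curry_uncurry P', h1]

/-- Every morphism of a topos has an image: the image of `f : X ⟶ Y` is the intersection of all
`V ∈ P Y` with `f⁻¹ V = X`. -/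
instance hasImages_topos : HasImages E where
  has_image {X Y} f := by
    let pf := (MonoidalClosed.pre f).app (HasSubobjectClassifier.Ω E)
    let top := MonoidalClosed.curry (tru (X ⊗ Pow Y))
    let t := equalizer.ι pf top
    have ht : t ≫ pf = t ≫ top := equalizer.condition _ _
    obtain ⟨φ, hφ⟩ : ∃ φ : equalizer pf top ⊗ Y ⟶ HasSubobjectClassifier.Ω E,
        ∀ (J : E) (a : J ⟶ equalizer pf top) (y : J ⟶ Y),
          lift a y ≫ φ = lift y (a ≫ t) ≫ memMap Y :=
      ⟨lift (snd _ Y) (fst _ Y ≫ t) ≫ memMap Y, fun J a y => by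
        rw [← Category.assoc]; congr 1; ext <;> simp⟩
    let ι := equalizer.ι (MonoidalClosed.curry φ) (MonoidalClosed.curry (tru _))
    have hf : f ≫ MonoidalClosed.curry φ = f ≫ MonoidalClosed.curry (tru _) := by
      apply pow_ext
      intro J g a
      rw [← Category.assoc, lift_curry_memMap, ← Category.assoc, lift_curry_memMap, hφ,
        ← pre_memMap, Category.assoc]
      change lift g (a ≫ t ≫ pf) ≫ _ = _
      rw [ht, ← Category.assoc, lift_curry_memMap, comp_tru, comp_tru]
    refine ⟨⟨⟨⟨_, ι, equalizer.lift f hf, equalizer.lift_ι _ _⟩, ?_⟩⟩⟩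
    have lift_ex : ∀ F' : MonoFactorisation f, ∃ y, y ≫ F'.m = ι := by
      intro F'
      rw [factors_iff_chi]
      let n : 𝟙_ E ⟶ Pow Y :=
        MonoidalClosed.curry (fst Y (𝟙_ E) ≫ HasSubobjectClassifier.χ F'.m)
      have hn : n ≫ pf = n ≫ top := by
        apply pow_ext
        intro J g a
        rw [← Category.assoc, pre_memMap, ← Category.assoc, lift_curry_memMap, lift_curry_memMap,
          lift_fst_assoc, Category.assoc, (factors_iff_chi F'.m f).1 ⟨F'.e, F'.fac⟩, comp_tru,
          comp_tru]
      have hn' : equalizer.lift n hn ≫ t = n := equalizer.lift_ι _ _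
      have hι : ι ≫ MonoidalClosed.curry φ = ι ≫ MonoidalClosed.curry (tru _) :=
        equalizer.condition _ _
      have h3 := congrArg (fun z => lift (toUnit _ ≫ equalizer.lift n hn) z ≫ memMap _) hι
      simp only [lift_curry_memMap, comp_tru] at h3
      rw [← h3]
      have h4 : ι ≫ HasSubobjectClassifier.χ F'.m = lift ι (toUnit _ ≫ n) ≫ memMap _ := by
        rw [lift_curry_memMap, lift_fst_assoc]
      rw [h4, hφ, Category.assoc, hn']
    exact ⟨fun F' => (lift_ex F').choose, fun F' => (lift_ex F').choose_spec⟩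

/-- The `I`-indexed subset `i ↦ {a(x) | u(x) = i}` of `A`. -/
def setOf {A X I : E} (u : X ⟶ I) (a : X ⟶ A) : I ⟶ Pow A :=
  MonoidalClosed.curry (HasSubobjectClassifier.χ (image.ι (lift a u)))

theorem mem_comp {A I J : E} (g : J ⟶ I) {a : I ⟶ A} {P : I ⟶ Pow A} (h : Mem a P) :
    Mem (g ≫ a) (g ≫ P) := by
  unfold Mem at *
  rw [← comp_lift, Category.assoc, h, comp_tru]

/-- Monomorphisms of a topos may be tested after covering by an epimorphism. -/
theorem factors_of_epi {U A I J : E} (m : U ⟶ A) [Mono m] (e : J ⟶ I) [Epi e] (x : I ⟶ A)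
    (h : ∃ y, y ≫ m = e ≫ x) : ∃ y, y ≫ m = x := by
  rw [factors_iff_chi] at h ⊢
  rw [← cancel_epi e, comp_tru, ← h, Category.assoc]

/-- Epimorphisms of a topos are stable under pullback along monomorphisms. -/
theorem epi_of_isPullback_mono {I J K L : E} {e' : L ⟶ K} {m' : L ⟶ J} {m : K ⟶ I} {e : J ⟶ I}
    (h : IsPullback m' e' e m) [Mono m] [Epi e] : Epi e' where
  left_cancellation {Z} a b hab := by
    obtain ⟨y, hy⟩ : ∃ y, y ≫ equalizer.ι a b = e' := ⟨equalizer.lift e' hab, equalizer.lift_ι _ _⟩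
    have heq : HasSubobjectClassifier.χ m = HasSubobjectClassifier.χ (equalizer.ι a b ≫ m) := by
      rw [← cancel_epi e]
      apply omega_ext
      intro S x
      rw [← Category.assoc, ← Category.assoc, ← factors_iff_chi, ← factors_iff_chi]
      constructor
      · rintro ⟨k, hk⟩
        exact ⟨h.lift x k hk.symm ≫ y, by
          rw [Category.assoc, reassoc_of% hy, h.lift_snd_assoc, hk]⟩
      · rintro ⟨k, hk⟩
        exact ⟨k ≫ equalizer.ι a b, by simpa using hk⟩
    obtain ⟨z, hz⟩ := (factors_iff_chi (equalizer.ι a b ≫ m) m).2 (by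
      rw [← heq, ← factors_iff_chi]; exact ⟨𝟙 _, by simp⟩)
    have hz' : z ≫ equalizer.ι a b = 𝟙 _ := by
      rw [← cancel_mono m]; simpa using hz
    rw [← Category.id_comp a, ← hz', Category.assoc, equalizer.condition, ← Category.assoc, hz',
      Category.id_comp]

theorem epi_of_isPullback {I J K L : E} {e' : L ⟶ K} {k' : L ⟶ J} {k : K ⟶ I} {e : J ⟶ I}
    (h : IsPullback k' e' e k) [Epi e] : Epi e' := by
  have : Epi (K ◁ e) := inferInstanceAs (Epi ((tensorLeft K).map e))
  have : Mono (lift (𝟙 K) k) := ⟨fun p q hpq => by simpa using congrArg (· ≫ fst _ _) hpq⟩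
  refine epi_of_isPullback_mono (m' := lift e' k') (m := lift (𝟙 K) k) (e := K ◁ e)
    ⟨⟨by ext <;> simp [h.w]⟩, ⟨PullbackCone.IsLimit.mk _
      (fun s => h.lift (s.fst ≫ snd _ _) s.snd ?_) ?_ ?_ ?_⟩⟩
  · simpa using congrArg (· ≫ snd _ _) s.condition
  · intro s
    have := congrArg (· ≫ fst _ _) s.condition
    ext <;> simp_all
  · intro s; simp
  · intro s p h1 h2
    apply h.hom_ext
    · simpa using congrArg (· ≫ snd _ _) h1
    · simpa using h2

/-- Every epimorphism into `I` can be restricted along `g : J ⟶ I`. -/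
theorem exists_cover {I J X : E} (e : X ⟶ I) [Epi e] (g : J ⟶ I) :
    ∃ (K : E) (d : K ⟶ J) (_ : Epi d) (x : K ⟶ X), x ≫ e = d ≫ g :=
  ⟨pullback e g, pullback.snd e g, epi_of_isPullback (IsPullback.of_hasPullback e g),
    pullback.fst e g, pullback.condition⟩

/-- `a ∈ {a'(x) | u(x) = i}` if and only if, locally, `a = a'(x)` with `u(x) = i`. -/
theorem mem_setOf {A X I J : E} (u : X ⟶ I) (a' : X ⟶ A) (i : J ⟶ I) (a : J ⟶ A) :
    Mem a (i ≫ setOf u a') ↔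
      ∃ (K : E) (d : K ⟶ J) (_ : Epi d) (x : K ⟶ X), x ≫ u = d ≫ i ∧ x ≫ a' = d ≫ a := by
  unfold Mem setOf
  rw [lift_curry_memMap, ← factors_iff_chi]
  constructor
  · rintro ⟨y, hy⟩
    obtain ⟨K, d, hd, x, hx⟩ := exists_cover (factorThruImage (lift a' u)) y
    have h := congrArg (· ≫ image.ι (lift a' u)) hx
    simp only [Category.assoc, image.fac, hy] at h
    exact ⟨K, d, hd, x, by simpa using congrArg (· ≫ snd _ _) h,
      by simpa using congrArg (· ≫ fst _ _) h⟩
  · rintro ⟨K, d, hd, x, h1, h2⟩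
    refine factors_of_epi _ d _ ⟨x ≫ factorThruImage (lift a' u), ?_⟩
    simp only [Category.assoc, image.fac]
    ext <;> simp [h1, h2]

/-- The total object `{(i, a) | a ∈ P i}` of an `I`-indexed subset `P : I ⟶ P A`. -/
def El {A I : E} (P : I ⟶ Pow A) : E :=
  pullback (A ◁ P ≫ memMap A) (HasSubobjectClassifier.truth E)

/-- The inclusion `El P ↪ A × I`. -/
def El.incl {A I : E} (P : I ⟶ Pow A) : El P ⟶ A ⊗ I :=
  pullback.fst (A ◁ P ≫ memMap A) (HasSubobjectClassifier.truth E)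

/-- The index of an element of an indexed subset. -/
def El.idx {A I : E} (P : I ⟶ Pow A) : El P ⟶ I := El.incl P ≫ snd A I

/-- The value of an element of an indexed subset. -/
def El.val {A I : E} (P : I ⟶ Pow A) : El P ⟶ A := El.incl P ≫ fst A I

theorem El.incl_mem {A I : E} (P : I ⟶ Pow A) : El.incl P ≫ A ◁ P ≫ memMap A = tru _ := by
  refine (pullback.condition (f := A ◁ P ≫ memMap A)
    (g := HasSubobjectClassifier.truth E)).trans ?_
  unfold tru; congr 1; exact Subsingleton.elim _ _

theorem El.exists_lift {A I J : E} (P : I ⟶ Pow A) (y : J ⟶ A ⊗ I)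
    (h : y ≫ A ◁ P ≫ memMap A = tru _) : ∃ x : J ⟶ El P, x ≫ El.incl P = y :=
  ⟨pullback.lift y (Subobject.Classifier.χ₀ _ J) h, pullback.lift_fst _ _ _⟩

theorem mem_iff_el {A I J : E} (P : I ⟶ Pow A) (i : J ⟶ I) (a : J ⟶ A) :
    Mem a (i ≫ P) ↔ ∃ x : J ⟶ El P, x ≫ El.idx P = i ∧ x ≫ El.val P = a := by
  unfold Mem El.idx El.val
  rw [← lift_whiskerLeft_assoc]
  constructor
  · intro h
    obtain ⟨x, hx⟩ := El.exists_lift P _ h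
    exact ⟨x, by rw [reassoc_of% hx, lift_snd], by rw [reassoc_of% hx, lift_fst]⟩
  · rintro ⟨x, rfl, rfl⟩
    rw [← comp_lift, ← comp_lift, lift_fst_snd, Category.comp_id, Category.assoc, El.incl_mem,
      comp_tru]

variable (E) in
/-- An internal commutative quantale of a topos, i.e. an internal partially ordered commutative
monoid with a join operation `sup : P Q ⟶ Q` for arbitrary subsets, such that `⊗` distributes over
joins. The axioms are spelled out for generalized elements `I ⟶ Q`. -/
structure CommQuantale where
  /-- The underlying object. -/
  carrier : E
  /-- The internal monoid `(⊗, k)`. -/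
  [mon : MonObj carrier]
  comm : ∀ {I : E} (x y : I ⟶ carrier), lift x y ≫ MonObj.mul = lift y x ≫ MonObj.mul
  /-- The internal order relation. -/
  le : Subobject (carrier ⊗ carrier)
  le_refl : ∀ {I : E} (x : I ⟶ carrier), le.Factors (lift x x)
  le_trans : ∀ {I : E} (x y z : I ⟶ carrier),
    le.Factors (lift x y) → le.Factors (lift y z) → le.Factors (lift x z)
  le_antisymm : ∀ {I : E} (x y : I ⟶ carrier),
    le.Factors (lift x y) → le.Factors (lift y x) → x = y
  /-- The join operation. -/
  sup : Pow carrier ⟶ carrier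
  /-- `⋁ P ≤ r ↔ ∀ q ∈ P, q ≤ r`. -/
  sup_le_iff : ∀ {I : E} (P : I ⟶ Pow carrier) (r : I ⟶ carrier),
    le.Factors (lift (P ≫ sup) r) ↔
      ∀ {J : E} (g : J ⟶ I) (q : J ⟶ carrier), Mem q (g ≫ P) → le.Factors (lift q (g ≫ r))
  /-- `a ⊗ ⋁ P = ⋁ {a ⊗ q | q ∈ P}`. -/
  mul_sup : ∀ {I : E} (a : I ⟶ carrier) (P : I ⟶ Pow carrier),
    lift a (P ≫ sup) ≫ MonObj.mul =
      setOf (El.idx P) (lift (El.idx P ≫ a) (El.val P) ≫ MonObj.mul) ≫ sup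

attribute [instance] CommQuantale.mon

variable (Q : CommQuantale E)

/-- Generalized elements of `Q` at stage `I` form a commutative monoid, with product
`x * y = lift x y ≫ μ` and unit `1 = toUnit I ≫ η`. -/
instance CommQuantale.commMonoid (I : E) : CommMonoid (I ⟶ Q.carrier) :=
  { Hom.monoid with mul_comm := Q.comm }

/-- Generalized elements of `Q` at stage `I` are partially ordered. -/
instance CommQuantale.partialOrder (I : E) : PartialOrder (I ⟶ Q.carrier) where
  le x y := Q.le.Factors (lift x y)
  le_refl := Q.le_refl
  le_trans := Q.le_trans
  le_antisymm := Q.le_antisymm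

/-- The join `i ↦ ⋁ {χ(x) | u(x) = i}`. -/
def CommQuantale.join {X I : E} (u : X ⟶ I) (χ : X ⟶ Q.carrier) : I ⟶ Q.carrier :=
  setOf u χ ≫ Q.sup

namespace CommQuantale

variable {Q}

theorem comp_mul {I J : E} (g : J ⟶ I) (x y : I ⟶ Q.carrier) :
    g ≫ (x * y) = (g ≫ x) * (g ≫ y) := by
  change g ≫ lift x y ≫ _ = lift _ _ ≫ _
  rw [← Category.assoc, comp_lift]

theorem comp_one {I J : E} (g : J ⟶ I) : g ≫ (1 : I ⟶ Q.carrier) = 1 := by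
  change g ≫ toUnit _ ≫ _ = toUnit _ ≫ _
  rw [← Category.assoc]; congr 1; exact toUnit_unique _ _

theorem comp_prod {ι : Type*} {I J : E} (g : J ⟶ I) (s : Finset ι) (x : ι → (I ⟶ Q.carrier)) :
    g ≫ (∏ i ∈ s, x i) = ∏ i ∈ s, g ≫ x i := by
  classical
  induction s using Finset.induction_on with
  | empty => simp
  | insert a s ha ih => rw [Finset.prod_insert ha, Finset.prod_insert ha, comp_mul, ih]

theorem comp_mono {I J : E} (g : J ⟶ I) {x y : I ⟶ Q.carrier} (h : x ≤ y) :
    g ≫ x ≤ g ≫ y := by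
  change Q.le.Factors (lift _ _)
  rw [← comp_lift]
  exact Subobject.factors_of_factors_right g h

theorem le_of_epi {I J : E} (e : J ⟶ I) [Epi e] {x y : I ⟶ Q.carrier} (h : e ≫ x ≤ e ≫ y) :
    x ≤ y := by
  change Q.le.Factors (lift x y)
  have h' : Q.le.Factors (lift _ _) := h
  rw [← comp_lift, Subobject.factors_iff] at h'
  rw [Subobject.factors_iff]
  obtain ⟨k, hk⟩ := h'
  exact factors_of_epi _ e _ ⟨k, hk⟩

/-- `⋁ {χ(x) | u(x) = i} ≤ r` if and only if `χ(x) ≤ r` whenever `u(x) = i`. -/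
theorem join_le_iff {X I K : E} {u : X ⟶ I} {χ : X ⟶ Q.carrier} (i : K ⟶ I) (r : K ⟶ Q.carrier) :
    i ≫ Q.join u χ ≤ r ↔
      ∀ (L : E) (g : L ⟶ K) (x : L ⟶ X), x ≫ u = g ≫ i → x ≫ χ ≤ g ≫ r := by
  unfold join
  rw [← Category.assoc]
  refine (Q.sup_le_iff (i ≫ setOf u χ) r).trans ?_
  constructor
  · intro h L g x hx
    refine h g (x ≫ χ) ?_
    rw [← Category.assoc, mem_setOf]
    exact ⟨L, 𝟙 L, inferInstance, x, by simpa using hx, by simp⟩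
  · intro h J g q hq
    rw [← Category.assoc, mem_setOf] at hq
    obtain ⟨L, d, hd, x, h1, h2⟩ := hq
    have := h L (d ≫ g) x (by simpa using h1)
    rw [h2, Category.assoc] at this
    exact le_of_epi d this

theorem le_join {X I L : E} {u : X ⟶ I} {χ : X ⟶ Q.carrier} (x : L ⟶ X) :
    x ≫ χ ≤ x ≫ u ≫ Q.join u χ := by
  have := (join_le_iff (u := u) (χ := χ) (x ≫ u) _).1 le_rfl L (𝟙 L) x (by simp)
  simpa using this

theorem le_join' {X I L : E} {u : X ⟶ I} {χ : X ⟶ Q.carrier} (x : L ⟶ X) {i : L ⟶ I}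
    (h : x ≫ u = i) : x ≫ χ ≤ i ≫ Q.join u χ := by
  rw [← h, Category.assoc]; exact le_join x

theorem mul_sup_le_iff {I : E} (c : I ⟶ Q.carrier) (P : I ⟶ Pow Q.carrier) (r : I ⟶ Q.carrier) :
    c * (P ≫ Q.sup) ≤ r ↔
      ∀ (L : E) (g : L ⟶ I) (q : L ⟶ Q.carrier), Mem q (g ≫ P) → (g ≫ c) * q ≤ g ≫ r := by
  have h : c * (P ≫ Q.sup) = 𝟙 I ≫ Q.join (El.idx P) ((El.idx P ≫ c) * El.val P) := by
    rw [Category.id_comp]; exact Q.mul_sup c P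
  rw [h, join_le_iff]
  constructor
  · intro h L g q hq
    obtain ⟨x, h1, h2⟩ := (mem_iff_el P g q).1 hq
    have := h L g x (by simpa using h1)
    rwa [comp_mul, ← Category.assoc, h1, h2] at this
  · intro h L g x hx
    have hx : x ≫ El.idx P = g := by simpa using hx
    rw [comp_mul, ← Category.assoc, hx]
    exact h L g _ ((mem_iff_el P g _).2 ⟨x, hx, rfl⟩)

/-- `c ⊗ ⋁ {χ(x) | u(x) = i} ≤ r` if and only if `c ⊗ χ(x) ≤ r` whenever `u(x) = i`. -/
theorem mul_join_le_iff {X I K : E} {u : X ⟶ I} {χ : X ⟶ Q.carrier} (c : K ⟶ Q.carrier)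
    (i : K ⟶ I) (r : K ⟶ Q.carrier) :
    c * (i ≫ Q.join u χ) ≤ r ↔ ∀ (L : E) (g : L ⟶ K) (x : L ⟶ X), x ≫ u = g ≫ i →
      (g ≫ c) * (x ≫ χ) ≤ g ≫ r := by
  unfold join
  rw [← Category.assoc, mul_sup_le_iff]
  constructor
  · intro h L g x hx
    refine h L g (x ≫ χ) ?_
    rw [← Category.assoc, mem_setOf]
    exact ⟨L, 𝟙 L, inferInstance, x, by simpa using hx, by simp⟩
  · intro h J g q hq
    rw [← Category.assoc, mem_setOf] at hq
    obtain ⟨L, d, hd, x, h1, h2⟩ := hq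
    have := h L (d ≫ g) x (by simpa using h1)
    rw [h2, Category.assoc, Category.assoc, ← comp_mul] at this
    exact le_of_epi d this

theorem mul_le_mul_of_le {I : E} (c : I ⟶ Q.carrier) {x y : I ⟶ Q.carrier} (h : x ≤ y) :
    c * x ≤ c * y := by
  have hj : Q.join (Q.le.arrow ≫ snd _ _) (Q.le.arrow ≫ fst _ _) = 𝟙 Q.carrier := by
    apply _root_.le_antisymm
    · rw [← Category.id_comp (Q.join _ _), join_le_iff]
      intro L g z hz
      change Q.le.Factors (lift _ _)
      rw [← hz, ← comp_lift, ← comp_lift, lift_fst_snd, Category.comp_id]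
      exact (Subobject.factors_iff _ _).2 ⟨z, rfl⟩
    · have hk := Q.le.factorThru_arrow _ (Q.le_refl (𝟙 Q.carrier))
      have := le_join' (u := Q.le.arrow ≫ snd _ _) (χ := Q.le.arrow ≫ fst _ _)
        (Q.le.factorThru _ (Q.le_refl (𝟙 Q.carrier))) (i := 𝟙 _)
        (by rw [reassoc_of% hk, lift_snd])
      rwa [reassoc_of% hk, lift_fst, Category.id_comp] at this
  have hk := Q.le.factorThru_arrow _ h
  have := (mul_join_le_iff (u := Q.le.arrow ≫ snd _ _) (χ := Q.le.arrow ≫ fst _ _) c y _).1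
    le_rfl I (𝟙 I) (Q.le.factorThru _ h) (by rw [reassoc_of% hk, lift_snd, Category.id_comp])
  rwa [reassoc_of% hk, hj, lift_fst, Category.id_comp, Category.id_comp, Category.comp_id] at this

instance isOrderedMonoid (I : E) : IsOrderedMonoid (I ⟶ Q.carrier) where
  mul_le_mul_left x y h c := by
    rw [mul_comm x, mul_comm y]
    exact mul_le_mul_of_le c h

/-- Elementwise form of distributivity of finite products over joins. -/
theorem mul_prod_join_le {X I : E} {u : X ⟶ I} {χ : X ⟶ Q.carrier} (n : ℕ) :
    ∀ {K : E} (c : K ⟶ Q.carrier) (i : Fin n → (K ⟶ I)) (r : K ⟶ Q.carrier),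
      (∀ (L : E) (g : L ⟶ K) (x : Fin n → (L ⟶ X)), (∀ j, x j ≫ u = g ≫ i j) →
        (g ≫ c) * (∏ j, x j ≫ χ) ≤ g ≫ r) →
      c * (∏ j, i j ≫ Q.join u χ) ≤ r := by
  induction n with
  | zero =>
    intro K c i r h
    simpa using h K (𝟙 K) Fin.elim0 (fun j => j.elim0)
  | succ n ih =>
    intro K c i r h
    rw [Fin.prod_univ_succ, mul_left_comm, mul_comm, mul_join_le_iff]
    intro L g x hx
    rw [comp_mul, comp_prod, mul_right_comm]
    simp only [← Category.assoc]
    refine ih _ _ _ fun M d y hy => ?_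
    have := h M (d ≫ g) (Fin.cons (d ≫ x) y) ?_
    · rw [Fin.prod_univ_succ] at this
      simpa [comp_mul, mul_assoc] using this
    · intro j
      cases j using Fin.cases with
      | zero => simp [hx]
      | succ j => simp [hy j]

theorem prod_join_le {X I K : E} {u : X ⟶ I} {χ : X ⟶ Q.carrier} {n : ℕ}
    (i : Fin n → (K ⟶ I)) (r : K ⟶ Q.carrier)
    (h : ∀ (L : E) (g : L ⟶ K) (x : Fin n → (L ⟶ X)), (∀ j, x j ≫ u = g ≫ i j) →
      (∏ j, x j ≫ χ) ≤ g ≫ r) :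
    (∏ j, i j ≫ Q.join u χ) ≤ r := by
  have := mul_prod_join_le (u := u) (χ := χ) n 1 i r fun L g x hx => by
    rw [comp_one, one_mul]; exact h L g x hx
  rwa [one_mul] at this

end CommQuantale

/-- A single-sorted algebraic signature: a type of operation symbols with finite arities. -/
structure Signature where
  /-- The operation symbols. -/
  Op : Type w
  /-- The arity of an operation symbol. -/
  arity : Op → ℕ

/-- Terms in `n` variables. -/
inductive Signature.Term (S : Signature.{w}) (n : ℕ) : Type w
  | var (i : Fin n) : Signature.Term S n
  | app (σ : S.Op) (t : Fin (S.arity σ) → Signature.Term S n) : Signature.Term S n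

/-- A presentation `(Σ, E)` of an algebraic variety: a signature and a set of equations, each
between two terms in a common finite context of variables. -/
structure Variety extends Signature.{w} where
  /-- The equations. -/
  eqs : Set (Σ n : ℕ, toSignature.Term n × toSignature.Term n)

/-- The power `A ^ n`. -/
abbrev power (A : E) (n : ℕ) : E := ∏ᶜ fun _ : Fin n => A

/-- The interpretation `A ^ n ⟶ A` of a term in `n` variables. -/
def Signature.Term.interp {S : Signature.{w}} {A : E} (op : ∀ σ : S.Op, power A (S.arity σ) ⟶ A)
    {n : ℕ} : S.Term n → (power A n ⟶ A)
  | var i => Pi.π (fun _ : Fin n => A) i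
  | app σ t => Pi.lift (fun j => (t j).interp op) ≫ op σ

theorem Signature.Term.interp_hom {S : Signature.{w}} {A B : E}
    {opA : ∀ σ : S.Op, power A (S.arity σ) ⟶ A} {opB : ∀ σ : S.Op, power B (S.arity σ) ⟶ B}
    (f : A ⟶ B) (hf : ∀ σ, opA σ ≫ f = Limits.Pi.map (fun _ => f) ≫ opB σ) {n : ℕ}
    (t : S.Term n) : t.interp opA ≫ f = Limits.Pi.map (fun _ => f) ≫ t.interp opB := by
  induction t with
  | var i => simp [interp]
  | app σ t ih =>
    simp only [interp, Category.assoc, hf]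
    rw [← Category.assoc, ← Category.assoc]
    congr 1
    refine Limits.Pi.hom_ext _ _ fun j => ?_
    simp [ih]

variable (T : Variety.{w})

variable (E) in
/-- A `(Σ, E)`-algebra internal to the topos. -/
structure Alg where
  /-- The underlying object. -/
  carrier : E
  /-- The operations. -/
  op : ∀ σ : T.Op, power carrier (T.arity σ) ⟶ carrier
  /-- The equations hold. -/
  sat : ∀ e ∈ T.eqs, e.2.1.interp op = e.2.2.interp op

variable {T}

namespace Alg

/-- The value of an operation on generalized elements at stage `I`. -/
def app (A : Alg E T) (σ : T.Op) {I : E} (a : Fin (T.arity σ) → (I ⟶ A.carrier)) :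
    I ⟶ A.carrier :=
  Pi.lift a ≫ A.op σ

theorem comp_app (A : Alg E T) (σ : T.Op) {I J : E} (g : J ⟶ I)
    (a : Fin (T.arity σ) → (I ⟶ A.carrier)) : g ≫ A.app σ a = A.app σ (fun j => g ≫ a j) := by
  unfold app
  rw [← Category.assoc]
  congr 1
  exact Limits.Pi.hom_ext _ _ fun j => by simp

/-- Homomorphisms of internal algebras. -/
def IsHom (A B : Alg E T) (f : A.carrier ⟶ B.carrier) : Prop :=
  ∀ σ, A.op σ ≫ f = Limits.Pi.map (fun _ => f) ≫ B.op σ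

theorem IsHom.app {A B : Alg E T} {f : A.carrier ⟶ B.carrier} (hf : A.IsHom B f) (σ : T.Op) {I : E}
    (a : Fin (T.arity σ) → (I ⟶ A.carrier)) : A.app σ a ≫ f = B.app σ (fun j => a j ≫ f) := by
  unfold Alg.app
  rw [Category.assoc, hf σ, ← Category.assoc]
  congr 1
  exact Limits.Pi.hom_ext _ _ fun j => by simp

theorem isHom_of_app {A B : Alg E T} {f : A.carrier ⟶ B.carrier}
    (h : ∀ (σ : T.Op) (I : E) (a : Fin (T.arity σ) → (I ⟶ A.carrier)),
      A.app σ a ≫ f = B.app σ (fun j => a j ≫ f)) : A.IsHom B f := by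
  intro σ
  have := h σ _ (Pi.π _)
  unfold Alg.app at this
  convert this using 2
  · symm
    convert Category.id_comp (A.op σ) using 2
    exact Limits.Pi.hom_ext _ _ fun j => by simp
  · exact Limits.Pi.hom_ext _ _ fun j => by simp

theorem isHom_id (A : Alg E T) : A.IsHom A (𝟙 _) := isHom_of_app fun σ I a => by simp

theorem IsHom.comp {A B C : Alg E T} {f : A.carrier ⟶ B.carrier} {g : B.carrier ⟶ C.carrier}
    (hf : A.IsHom B f) (hg : B.IsHom C g) : A.IsHom C (f ≫ g) :=
  isHom_of_app fun σ I a => by simp [← Category.assoc, hf.app, hg.app]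

/-- The product of two algebras. -/
abbrev prod (A B : Alg E T) : Alg E T where
  carrier := A.carrier ⊗ B.carrier
  op σ := lift (Limits.Pi.map (fun _ => fst _ _) ≫ A.op σ) (Limits.Pi.map (fun _ => snd _ _) ≫ B.op σ)
  sat e he := by
    apply CartesianMonoidalCategory.hom_ext
    · rw [Signature.Term.interp_hom _ (opB := A.op) (fun σ => by simp),
        Signature.Term.interp_hom _ (opB := A.op) (fun σ => by simp), A.sat e he]
    · rw [Signature.Term.interp_hom _ (opB := B.op) (fun σ => by simp),
        Signature.Term.interp_hom _ (opB := B.op) (fun σ => by simp), B.sat e he]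

variable (E T) in
/-- The terminal algebra. -/
abbrev terminal : Alg E T where
  carrier := 𝟙_ E
  op _ := toUnit _
  sat _ _ := toUnit_unique _ _

theorem isHom_fst (A B : Alg E T) : (A.prod B).IsHom A (fst _ _) := fun _ => lift_fst _ _

theorem isHom_snd (A B : Alg E T) : (A.prod B).IsHom B (snd _ _) := fun _ => lift_snd _ _

theorem isHom_toUnit (A : Alg E T) : A.IsHom (terminal E T) (toUnit _) := fun _ => toUnit_unique _ _

theorem IsHom.pair {A B C : Alg E T} {f : C.carrier ⟶ A.carrier} {g : C.carrier ⟶ B.carrier}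
    (hf : C.IsHom A f) (hg : C.IsHom B g) : C.IsHom (A.prod B) (lift f g) :=
  isHom_of_app fun σ I a => by
    apply CartesianMonoidalCategory.hom_ext
    · rw [(isHom_fst A B).app, Category.assoc, lift_fst, hf.app]; simp
    · rw [(isHom_snd A B).app, Category.assoc, lift_snd, hg.app]; simp

theorem IsHom.tensor {A B C D : Alg E T} {f : A.carrier ⟶ B.carrier} {g : C.carrier ⟶ D.carrier}
    (hf : A.IsHom B f) (hg : C.IsHom D g) : (A.prod C).IsHom (B.prod D) (f ⊗ₘ g) := by
  have := ((isHom_fst A C).comp hf).pair ((isHom_snd A C).comp hg)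
  rwa [lift_fst_comp_snd_comp] at this

theorem isHom_assoc (A B C : Alg E T) : ((A.prod B).prod C).IsHom (A.prod (B.prod C))
    (α_ A.carrier B.carrier C.carrier).hom := by
  have := ((isHom_fst (A.prod B) C).comp (isHom_fst A B)).pair
    (((isHom_fst (A.prod B) C).comp (isHom_snd A B)).pair (isHom_snd (A.prod B) C))
  convert this using 1
  ext <;> simp

theorem isHom_assoc_inv (A B C : Alg E T) : (A.prod (B.prod C)).IsHom ((A.prod B).prod C)
    (α_ A.carrier B.carrier C.carrier).inv := by
  have := ((isHom_fst A (B.prod C)).pair ((isHom_snd A (B.prod C)).comp (isHom_fst B C))).pair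
    ((isHom_snd A (B.prod C)).comp (isHom_snd B C))
  convert this using 1
  ext <;> simp

theorem isHom_leftUnitor (A : Alg E T) : ((terminal E T).prod A).IsHom A (λ_ A.carrier).hom := by
  rw [leftUnitor_hom]; exact isHom_snd _ _

theorem isHom_leftUnitor_inv (A : Alg E T) : A.IsHom ((terminal E T).prod A)
    (λ_ A.carrier).inv := by
  convert (isHom_toUnit A).pair (isHom_id A) using 1
  ext <;> simp

theorem isHom_rightUnitor (A : Alg E T) : (A.prod (terminal E T)).IsHom A (ρ_ A.carrier).hom := by
  rw [rightUnitor_hom]; exact isHom_fst _ _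

theorem isHom_rightUnitor_inv (A : Alg E T) : A.IsHom (A.prod (terminal E T))
    (ρ_ A.carrier).inv := by
  convert (isHom_id A).pair (isHom_toUnit A) using 1
  ext <;> simp

/-- The exchange morphism `A × B ⟶ B × A`. -/
abbrev swap (A B : Alg E T) : A.carrier ⊗ B.carrier ⟶ B.carrier ⊗ A.carrier :=
  lift (snd _ _) (fst _ _)

theorem isHom_swap (A B : Alg E T) : (A.prod B).IsHom (B.prod A) (A.swap B) :=
  (isHom_snd A B).pair (isHom_fst A B)

theorem prod_app (A B : Alg E T) (σ : T.Op) {I : E}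
    (x : Fin (T.arity σ) → (I ⟶ (A.prod B).carrier)) : (A.prod B).app σ x =
      lift (A.app σ (fun j => x j ≫ fst _ _))
        (B.app σ (fun j => x j ≫ snd _ _)) := by
  apply CartesianMonoidalCategory.hom_ext
  · rw [lift_fst]; exact (isHom_fst A B).app σ x
  · rw [lift_snd]; exact (isHom_snd A B).app σ x

end Alg

/-- An algebraic `Q`-relation from `A` to `B`: a morphism `R : A × B ⟶ Q` such that
`R(a₁,b₁) ⊗ ⋯ ⊗ R(aₙ,bₙ) ≤ R(σ(a₁,…,aₙ), σ(b₁,…,bₙ))` for every operation `σ`. -/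
@[ext]
structure AlgRel (Q : CommQuantale E) (A B : Alg E T) where
  /-- The underlying `Q`-relation. -/
  rel : A.carrier ⊗ B.carrier ⟶ Q.carrier
  alg : ∀ (σ : T.Op) {I : E} (a : Fin (T.arity σ) → (I ⟶ A.carrier))
    (b : Fin (T.arity σ) → (I ⟶ B.carrier)),
    (∏ j, lift (a j) (b j) ≫ rel) ≤ lift (A.app σ a) (B.app σ b) ≫ rel

namespace AlgRel

variable {Q}
variable {A B C D A' B' C' : Alg E T}

theorem le_of_elem {X Y : E} {R S : X ⊗ Y ⟶ Q.carrier}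
    (h : ∀ (I : E) (a : I ⟶ X) (b : I ⟶ Y), lift a b ≫ R ≤ lift a b ≫ S) : R ≤ S := by
  have := h _ (fst X Y) (snd X Y)
  rwa [lift_fst_snd, Category.id_comp, Category.id_comp] at this

theorem eq_of_elem {X Y : E} {R S : X ⊗ Y ⟶ Q.carrier}
    (h : ∀ (I : E) (a : I ⟶ X) (b : I ⟶ Y), lift a b ≫ R = lift a b ≫ S) : R = S :=
  le_antisymm (le_of_elem fun I a b => (h I a b).le) (le_of_elem fun I a b => (h I a b).ge)

variable (Q) in
/-- `f_∘(a, b) = ⋁ {k | f(a) = b}`. -/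
def graphRel {X Y : E} (f : X ⟶ Y) : X ⊗ Y ⟶ Q.carrier := Q.join (lift (𝟙 X) f) 1

theorem graphRel_elem {X Y I : E} (f : X ⟶ Y) (a : I ⟶ X) (b : I ⟶ Y) (c r : I ⟶ Q.carrier) :
    c * (lift a b ≫ graphRel Q f) ≤ r ↔
      ∀ (L : E) (g : L ⟶ I), g ≫ a ≫ f = g ≫ b → g ≫ c ≤ g ≫ r := by
  unfold graphRel
  rw [CommQuantale.mul_join_le_iff]
  constructor
  · intro h L g hg
    have := h L g (g ≫ a) (by simp [hg])
    rwa [CommQuantale.comp_one, mul_one] at this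
  · intro h L g x hx
    rw [CommQuantale.comp_one, mul_one]
    rw [comp_lift, comp_lift, Category.comp_id] at hx
    have h1 := congrArg (· ≫ fst _ _) hx
    have h2 := congrArg (· ≫ snd _ _) hx
    simp only [lift_fst, lift_snd] at h1 h2
    exact h L g (by rw [← h2, h1, Category.assoc])

theorem one_le_graphRel {X Y I : E} (f : X ⟶ Y) (a : I ⟶ X) {b : I ⟶ Y} (h : a ≫ f = b) :
    (1 : I ⟶ Q.carrier) ≤ lift a b ≫ graphRel Q f := by
  have := CommQuantale.le_join' (Q := Q) (u := lift (𝟙 X) f) (χ := 1) a (i := lift a b)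
    (by simp [h])
  rwa [CommQuantale.comp_one] at this

/-- `(S ∘ R)(a, c) = ⋁ {R(a, b) ⊗ S(b, c) | b ∈ B}`. -/
def compRel {X Y Z : E} (R : X ⊗ Y ⟶ Q.carrier) (S : Y ⊗ Z ⟶ Q.carrier) : X ⊗ Z ⟶ Q.carrier :=
  Q.join (X := X ⊗ (Y ⊗ Z)) (lift (fst _ _) (snd _ _ ≫ snd _ _))
    ((lift (fst _ _) (snd _ _ ≫ fst _ _) ≫ R) * (snd _ _ ≫ S))

theorem compRel_elem {X Y Z I : E} {R : X ⊗ Y ⟶ Q.carrier} {S : Y ⊗ Z ⟶ Q.carrier}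
    (a : I ⟶ X) (c : I ⟶ Z) (q r : I ⟶ Q.carrier) :
    q * (lift a c ≫ compRel R S) ≤ r ↔ ∀ (L : E) (g : L ⟶ I) (b : L ⟶ Y),
      (g ≫ q) * ((lift (g ≫ a) b ≫ R) * (lift b (g ≫ c) ≫ S)) ≤ g ≫ r := by
  unfold compRel
  rw [CommQuantale.mul_join_le_iff]
  constructor
  · intro h L g b
    have := h L g (lift (g ≫ a) (lift b (g ≫ c))) (by simp)
    rw [CommQuantale.comp_mul] at this
    simpa [comp_lift_assoc] using this
  · intro h L g x hx
    have h1 := congrArg (· ≫ fst _ _) hx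
    have h2 := congrArg (· ≫ snd _ _) hx
    simp only [Category.assoc, lift_fst, lift_snd] at h1 h2
    have := h L g (x ≫ snd _ _ ≫ fst _ _)
    have h3 : lift (x ≫ snd _ _ ≫ fst _ _) (x ≫ snd _ _ ≫ snd _ _) = x ≫ snd _ _ := by
      rw [← comp_lift, ← comp_lift, lift_fst_snd, Category.comp_id]
    rw [CommQuantale.comp_mul]
    rwa [← h1, ← h2, ← comp_lift_assoc, h3, Category.assoc] at this

theorem le_compRel {X Y Z I : E} {R : X ⊗ Y ⟶ Q.carrier} {S : Y ⊗ Z ⟶ Q.carrier}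
    (a : I ⟶ X) (b : I ⟶ Y) (c : I ⟶ Z) :
    (lift a b ≫ R) * (lift b c ≫ S) ≤ lift a c ≫ compRel R S := by
  have := (compRel_elem (R := R) (S := S) a c 1 _).1 le_rfl I (𝟙 I) b
  simpa using this

theorem compRel_le {X Y Z I : E} {R : X ⊗ Y ⟶ Q.carrier} {S : Y ⊗ Z ⟶ Q.carrier}
    (a : I ⟶ X) (c : I ⟶ Z) (r : I ⟶ Q.carrier) (h : ∀ (L : E) (g : L ⟶ I) (b : L ⟶ Y),
      (lift (g ≫ a) b ≫ R) * (lift b (g ≫ c) ≫ S) ≤ g ≫ r) :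
    lift a c ≫ compRel R S ≤ r := by
  have := (compRel_elem (R := R) (S := S) a c 1 r).2 (by simpa using h)
  simpa using this

theorem comp_elem {X Y I J : E} (g : J ⟶ I) (a : I ⟶ X) (b : I ⟶ Y) (R : X ⊗ Y ⟶ Q.carrier) :
    g ≫ lift a b ≫ R = lift (g ≫ a) (g ≫ b) ≫ R := comp_lift_assoc _ _ _ _

theorem compRel_assoc {X Y Z W : E} (R : X ⊗ Y ⟶ Q.carrier) (S : Y ⊗ Z ⟶ Q.carrier)
    (U : Z ⊗ W ⟶ Q.carrier) : compRel (compRel R S) U = compRel R (compRel S U) := by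
  apply le_antisymm
  · refine le_of_elem fun I a d => compRel_le _ _ _ fun L g c => ?_
    rw [mul_comm, compRel_elem]
    intro M h b
    rw [mul_comm, mul_assoc, comp_elem, comp_elem, comp_elem]
    exact (mul_le_mul_right (le_compRel _ _ _) _).trans (le_compRel _ _ _)
  · refine le_of_elem fun I a d => compRel_le _ _ _ fun L g b => ?_
    rw [compRel_elem]
    intro M h c
    rw [← mul_assoc, comp_elem, comp_elem, comp_elem]
    exact (mul_le_mul_left (le_compRel _ _ _) _).trans (le_compRel _ _ _)

theorem graphRel_compRel {X Y Z : E} (f : X ⟶ Y) (R : Y ⊗ Z ⟶ Q.carrier) :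
    compRel (graphRel Q f) R = lift (fst _ _ ≫ f) (snd _ _) ≫ R := by
  apply le_antisymm
  · refine le_of_elem fun I a c => compRel_le _ _ _ fun L g b => ?_
    rw [mul_comm, graphRel_elem]
    intro M h hb
    simp only [comp_elem, lift_fst_assoc, lift_snd, Category.assoc] at hb ⊢
    rw [hb]
  · refine le_of_elem fun I a c => ?_
    have := mul_le_mul_left (one_le_graphRel (Q := Q) f a rfl) (lift (a ≫ f) c ≫ R)
    rw [one_mul] at this
    simpa [comp_lift_assoc] using this.trans (le_compRel _ _ _)

theorem compRel_graphRel {X Y Z : E} (R : X ⊗ Y ⟶ Q.carrier) (f : Y ⟶ Z) (f' : Z ⟶ Y)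
    (h₁ : f ≫ f' = 𝟙 _) (h₂ : f' ≫ f = 𝟙 _) :
    compRel R (graphRel Q f) = lift (fst _ _) (snd _ _ ≫ f') ≫ R := by
  apply le_antisymm
  · refine le_of_elem fun I a c => compRel_le _ _ _ fun L g b => ?_
    rw [graphRel_elem]
    intro M h hb
    have hb' : h ≫ b = h ≫ g ≫ c ≫ f' := by
      have := congrArg (· ≫ f') hb
      simpa [h₁] using this
    simp only [comp_elem, lift_fst, lift_snd_assoc, hb']
    exact le_rfl
  · refine le_of_elem fun I a c => ?_
    have := mul_le_mul_right (one_le_graphRel (Q := Q) f (c ≫ f') (b := c) (by simp [h₂]))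
      (lift a (c ≫ f') ≫ R)
    rw [mul_one] at this
    simpa [comp_lift_assoc] using this.trans (le_compRel _ _ _)

/-- The graph of a homomorphism. -/
def graph (f : A.carrier ⟶ B.carrier) (hf : A.IsHom B f) : AlgRel Q A B where
  rel := graphRel Q f
  alg σ I a b := by
    refine CommQuantale.prod_join_le _ _ fun L g x hx => ?_
    have h1 : ∀ j, x j = g ≫ a j := fun j => by
      simpa using congrArg (· ≫ fst _ _) (hx j)
    have h2 : ∀ j, x j ≫ f = g ≫ b j := fun j => by
      simpa using congrArg (· ≫ snd _ _) (hx j)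
    rw [Finset.prod_congr rfl (fun j _ => CommQuantale.comp_one _), Finset.prod_const_one,
      comp_elem, Alg.comp_app, Alg.comp_app]
    refine one_le_graphRel _ _ ?_
    rw [hf.app]
    congr 1
    funext j
    rw [← h1, h2]

/-- The identity relation `1_A(a, a') = ⋁ {k | a = a'}`. -/
def id (A : Alg E T) : AlgRel Q A A := graph (𝟙 _) A.isHom_id

/-- Composition of algebraic `Q`-relations. -/
def comp (R : AlgRel Q A B) (S : AlgRel Q B C) : AlgRel Q A C where
  rel := compRel R.rel S.rel
  alg σ I a c := by
    unfold compRel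
    refine CommQuantale.prod_join_le _ _ fun L g x hx => ?_
    have h1 : ∀ j, x j ≫ fst _ _ = g ≫ a j := fun j => by
      simpa using congrArg (· ≫ fst _ _) (hx j)
    have h2 : ∀ j, x j ≫ snd _ _ ≫ snd _ _ = g ≫ c j := fun j => by
      simpa using congrArg (· ≫ snd _ _) (hx j)
    have h3 : ∀ j, x j ≫ snd _ _ ≫ S.rel =
        lift (x j ≫ snd _ _ ≫ fst _ _) (g ≫ c j) ≫ S.rel := fun j => by
      rw [← h2, ← comp_lift_assoc, ← comp_lift, lift_fst_snd, Category.comp_id]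
    simp only [CommQuantale.comp_mul, Finset.prod_mul_distrib, h3]
    simp only [comp_lift_assoc, h1]
    refine (mul_le_mul' (R.alg σ _ _) (S.alg σ _ _)).trans ?_
    rw [Alg.comp_app, Alg.comp_app]
    exact le_compRel _ _ _

/-- `(R ⊗ R')((a, a'), (b, b')) = R(a, b) ⊗ R'(a', b')`. -/
def tensor (R : AlgRel Q A B) (R' : AlgRel Q A' B') : AlgRel Q (A.prod A') (B.prod B') where
  rel := (lift (fst _ _ ≫ fst _ _) (snd _ _ ≫ fst _ _) ≫ R.rel) *
    (lift (fst _ _ ≫ snd _ _) (snd _ _ ≫ snd _ _) ≫ R'.rel)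
  alg σ I a b := by
    simp only [CommQuantale.comp_mul, Finset.prod_mul_distrib, comp_lift_assoc, lift_fst_assoc,
      lift_snd_assoc, Alg.prod_app, lift_fst, lift_snd]
    exact mul_le_mul' (R.alg σ _ _) (R'.alg σ _ _)

theorem tensor_elem (R : AlgRel Q A B) (R' : AlgRel Q A' B') {I : E}
    (a : I ⟶ A.carrier ⊗ A'.carrier) (b : I ⟶ B.carrier ⊗ B'.carrier) :
    lift a b ≫ (R.tensor R').rel = (lift (a ≫ fst _ _) (b ≫ fst _ _) ≫ R.rel) *
      (lift (a ≫ snd _ _) (b ≫ snd _ _) ≫ R'.rel) := by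
  simp only [tensor, CommQuantale.comp_mul, comp_lift_assoc, lift_fst_assoc, lift_snd_assoc]

theorem graph_comp (f : A.carrier ⟶ B.carrier) (hf : A.IsHom B f) (R : AlgRel Q B C) :
    ((graph f hf).comp R).rel = lift (fst _ _ ≫ f) (snd _ _) ≫ R.rel :=
  graphRel_compRel f R.rel

theorem graph_comp_graph (f : A.carrier ⟶ B.carrier) (hf : A.IsHom B f)
    (g : B.carrier ⟶ C.carrier) (hg : B.IsHom C g) :
    (graph f hf).comp (graph g hg) = graph (Q := Q) (f ≫ g) (hf.comp hg) := by
  ext1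
  rw [graph_comp]
  apply le_antisymm
  · refine le_of_elem fun I a c => ?_
    rw [← one_mul (lift a c ≫ lift _ _ ≫ _), comp_lift_assoc, graph, graphRel_elem]
    intro L k hk
    rw [CommQuantale.comp_one, graph, comp_elem]
    exact one_le_graphRel _ _ (by simpa using hk)
  · refine le_of_elem fun I a c => ?_
    rw [← one_mul (lift a c ≫ _), graph, graphRel_elem]
    intro L k hk
    rw [CommQuantale.comp_one, graph, comp_lift_assoc, comp_elem]
    exact one_le_graphRel _ _ (by simpa using hk)

theorem graph_tensor_graph (f : A.carrier ⟶ B.carrier) (hf : A.IsHom B f)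
    (g : A'.carrier ⟶ B'.carrier) (hg : A'.IsHom B' g) :
    (graph f hf).tensor (graph g hg) = graph (Q := Q) (f ⊗ₘ g) (hf.tensor hg) := by
  ext1
  apply le_antisymm
  · refine le_of_elem fun I a b => ?_
    rw [tensor_elem, graph, graph, graphRel_elem]
    intro L k hk
    rw [← one_mul (k ≫ lift _ _ ≫ _), comp_elem, graphRel_elem]
    intro M l hl
    rw [CommQuantale.comp_one, graph, comp_elem, comp_elem]
    refine one_le_graphRel _ _ ?_
    have hk := congrArg (l ≫ ·) hk
    apply CartesianMonoidalCategory.hom_ext <;> simp_all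
  · refine le_of_elem fun I a b => ?_
    rw [← one_mul (lift a b ≫ _), graph, graphRel_elem]
    intro L k hk
    rw [CommQuantale.comp_one, tensor_elem, CommQuantale.comp_mul, graph, graph, comp_elem,
      comp_elem, ← one_mul (1 : L ⟶ Q.carrier)]
    have h1 := congrArg (· ≫ fst _ _) hk
    have h2 := congrArg (· ≫ snd _ _) hk
    exact mul_le_mul' (one_le_graphRel _ _ (by simpa using h1))
      (one_le_graphRel _ _ (by simpa using h2))

theorem tensor_comp (R : AlgRel Q A B) (S : AlgRel Q B C) (R' : AlgRel Q A' B')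
    (S' : AlgRel Q B' C') : (R.tensor R').comp (S.tensor S') = (R.comp S).tensor (R'.comp S') := by
  ext1
  apply le_antisymm
  · refine le_of_elem fun I a c => compRel_le _ _ _ fun L g b => ?_
    rw [tensor_elem, tensor_elem, tensor_elem, mul_mul_mul_comm, CommQuantale.comp_mul, comp_elem,
      comp_elem]
    simp only [Category.assoc]
    exact mul_le_mul' (le_compRel _ _ _) (le_compRel _ _ _)
  · refine le_of_elem fun I a c => ?_
    rw [tensor_elem, comp, comp, compRel_elem]
    intro L g b'
    rw [comp_elem, mul_comm, compRel_elem]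
    intro M h b
    have := le_compRel (R := (R.tensor R').rel) (S := (S.tensor S').rel) (h ≫ g ≫ a)
      (lift b (h ≫ b')) (h ≫ g ≫ c)
    rw [comp_elem, comp_elem, CommQuantale.comp_mul, mul_comm, mul_mul_mul_comm, comp_elem,
      comp_elem]
    rw [tensor_elem, tensor_elem] at this
    change _ ≤ lift _ _ ≫ compRel (R.tensor R').rel (S.tensor S').rel
    simpa using this

theorem graph_congr {f g : A.carrier ⟶ B.carrier} (h : f = g) (hf : A.IsHom B f)
    (hg : A.IsHom B g) : graph (Q := Q) f hf = graph g hg := by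
  subst h; rfl

theorem naturality (R : AlgRel Q A B) (S : AlgRel Q C D) (f : A.carrier ⟶ C.carrier)
    (hf : A.IsHom C f) (g : B.carrier ⟶ D.carrier) (hg : B.IsHom D g)
    (g' : D.carrier ⟶ B.carrier) (h₁ : g ≫ g' = 𝟙 _) (h₂ : g' ≫ g = 𝟙 _)
    (h : ∀ (I : E) (a : I ⟶ A.carrier) (d : I ⟶ D.carrier),
      lift a (d ≫ g') ≫ R.rel = lift (a ≫ f) d ≫ S.rel) :
    R.comp (graph g hg) = (graph f hf).comp S := by
  ext1
  refine (compRel_graphRel _ g g' h₁ h₂).trans (Eq.trans ?_ (graph_comp f hf S).symm)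
  exact h _ _ _

theorem assoc_naturality (R : AlgRel Q A A') (S : AlgRel Q B B') (U : AlgRel Q C C') :
    ((R.tensor S).tensor U).comp (graph _ (Alg.isHom_assoc A' B' C')) =
      (graph _ (Alg.isHom_assoc A B C)).comp (R.tensor (S.tensor U)) := by
  refine naturality _ _ _ _ _ _ _ (Iso.hom_inv_id _) (Iso.inv_hom_id _) fun I a d => ?_
  rw [tensor_elem, tensor_elem, tensor_elem, tensor_elem]
  simp [mul_assoc]

theorem id_elem {I : E} (a b : I ⟶ 𝟙_ E) : lift a b ≫ (AlgRel.id (Q := Q) (Alg.terminal E T)).rel = 1 := by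
  apply le_antisymm
  · rw [← one_mul (lift a b ≫ _)]
    exact (graphRel_elem _ _ _ _ _).2 fun L g _ => le_rfl
  · exact one_le_graphRel _ _ (toUnit_unique _ _)

theorem leftUnitor_naturality (R : AlgRel Q A B) :
    ((AlgRel.id (Alg.terminal E T)).tensor R).comp (graph _ (Alg.isHom_leftUnitor B)) =
      (graph _ (Alg.isHom_leftUnitor A)).comp R := by
  refine naturality _ _ _ _ _ _ _ (Iso.hom_inv_id _) (Iso.inv_hom_id _) fun I a d => ?_
  rw [tensor_elem, id_elem, one_mul, leftUnitor_hom]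
  simp

theorem rightUnitor_naturality (R : AlgRel Q A B) :
    (R.tensor (AlgRel.id (Alg.terminal E T))).comp (graph _ (Alg.isHom_rightUnitor B)) =
      (graph _ (Alg.isHom_rightUnitor A)).comp R := by
  refine naturality _ _ _ _ _ _ _ (Iso.hom_inv_id _) (Iso.inv_hom_id _) fun I a d => ?_
  rw [tensor_elem, id_elem, mul_one, rightUnitor_hom]
  simp

theorem swap_naturality (R : AlgRel Q A A') (S : AlgRel Q B B') :
    (R.tensor S).comp (graph _ (Alg.isHom_swap A' B')) =
      (graph _ (Alg.isHom_swap A B)).comp (S.tensor R) := by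
  refine naturality _ _ _ _ _ _ (B'.swap A') (by ext <;> simp) (by ext <;> simp) fun I a d => ?_
  rw [tensor_elem, tensor_elem, mul_comm]
  simp

theorem pentagon (A B C D : Alg E T) :
    ((graph _ (Alg.isHom_assoc A B C)).tensor (AlgRel.id D)).comp
      ((graph _ (Alg.isHom_assoc A (B.prod C) D)).comp
        ((AlgRel.id A).tensor (graph _ (Alg.isHom_assoc B C D)))) =
      (graph (Q := Q) _ (Alg.isHom_assoc (A.prod B) C D)).comp
        (graph _ (Alg.isHom_assoc A B (C.prod D))) := by
  simp only [AlgRel.id, graph_tensor_graph, graph_comp_graph]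
  apply graph_congr
  simp

theorem triangle (A B : Alg E T) :
    (graph _ (Alg.isHom_assoc A (Alg.terminal E T) B)).comp
      ((AlgRel.id A).tensor (graph _ (Alg.isHom_leftUnitor B))) =
      (graph (Q := Q) _ (Alg.isHom_rightUnitor A)).tensor (AlgRel.id B) := by
  simp only [AlgRel.id, graph_tensor_graph, graph_comp_graph]
  apply graph_congr
  simp

theorem hexagon_forward (A B C : Alg E T) :
    (graph _ (Alg.isHom_assoc A B C)).comp
      ((graph _ (Alg.isHom_swap A (B.prod C))).comp (graph _ (Alg.isHom_assoc B C A))) =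
    ((graph (Q := Q) _ (Alg.isHom_swap A B)).tensor (AlgRel.id C)).comp
      ((graph _ (Alg.isHom_assoc B A C)).comp
        ((AlgRel.id B).tensor (graph _ (Alg.isHom_swap A C)))) := by
  simp only [AlgRel.id, graph_tensor_graph, graph_comp_graph]
  apply graph_congr
  ext <;> simp

theorem hexagon_reverse (A B C : Alg E T) :
    (graph _ (Alg.isHom_assoc_inv A B C)).comp
      ((graph _ (Alg.isHom_swap (A.prod B) C)).comp (graph _ (Alg.isHom_assoc_inv C A B))) =
    ((AlgRel.id A).tensor (graph (Q := Q) _ (Alg.isHom_swap B C))).comp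
      ((graph _ (Alg.isHom_assoc_inv A C B)).comp
        ((graph _ (Alg.isHom_swap A C)).tensor (AlgRel.id B))) := by
  simp only [AlgRel.id, graph_tensor_graph, graph_comp_graph]
  apply graph_congr
  ext <;> simp

end AlgRel

variable (T) in
/-- The category `Rel_{(Σ,E)}(Q)`: objects are `(Σ, E)`-algebras, morphisms are algebraic
`Q`-relations. -/
structure RelCat (Q : CommQuantale E) where
  /-- The underlying algebra. -/
  alg : Alg E T

namespace RelCat

variable {Q}

open AlgRel

instance : Category (RelCat T Q) where
  Hom A B := AlgRel Q A.alg B.alg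
  id A := AlgRel.id A.alg
  comp R S := R.comp S
  id_comp {A B} R := by
    ext1
    rw [AlgRel.id, graph_comp, Category.comp_id, lift_fst_snd, Category.id_comp]
  comp_id {A B} R := by
    ext1
    refine (compRel_graphRel R.rel (𝟙 _) (𝟙 _) (by simp) (by simp)).trans ?_
    rw [Category.comp_id, lift_fst_snd, Category.id_comp]
  assoc R S U := AlgRel.ext (compRel_assoc R.rel S.rel U.rel)

variable {A B C D : RelCat T Q}

/-- The `Q`-relation underlying a morphism. -/
def rel (R : A ⟶ B) : A.alg.carrier ⊗ B.alg.carrier ⟶ Q.carrier := AlgRel.rel R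

/-- The isomorphism given by the graph of an isomorphism of algebras. -/
def graphIso (A B : RelCat T Q) (f : A.alg.carrier ≅ B.alg.carrier) (hf : A.alg.IsHom B.alg f.hom)
    (hg : B.alg.IsHom A.alg f.inv) : A ≅ B where
  hom := graph f.hom hf
  inv := graph f.inv hg
  hom_inv_id := (graph_comp_graph _ hf _ hg).trans (graph_congr f.hom_inv_id _ A.alg.isHom_id)
  inv_hom_id := (graph_comp_graph _ hg _ hf).trans (graph_congr f.inv_hom_id _ B.alg.isHom_id)

/-- The tensor of objects is the product of algebras, the unit is the terminal algebra, and the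
coherence isomorphisms are the graphs of those of the topos. -/
instance : MonoidalCategoryStruct (RelCat T Q) where
  tensorObj A B := ⟨A.alg.prod B.alg⟩
  tensorHom R S := AlgRel.tensor R S
  whiskerLeft A _ _ R := AlgRel.tensor (AlgRel.id A.alg) R
  whiskerRight R A := AlgRel.tensor R (AlgRel.id A.alg)
  tensorUnit := ⟨Alg.terminal E T⟩
  associator A B C := graphIso ⟨(A.alg.prod B.alg).prod C.alg⟩ ⟨A.alg.prod (B.alg.prod C.alg)⟩
    (α_ _ _ _) (Alg.isHom_assoc A.alg B.alg C.alg) (Alg.isHom_assoc_inv A.alg B.alg C.alg)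
  leftUnitor A := graphIso ⟨(Alg.terminal E T).prod A.alg⟩ A (λ_ _)
    (Alg.isHom_leftUnitor A.alg) (Alg.isHom_leftUnitor_inv A.alg)
  rightUnitor A := graphIso ⟨A.alg.prod (Alg.terminal E T)⟩ A (ρ_ _)
    (Alg.isHom_rightUnitor A.alg) (Alg.isHom_rightUnitor_inv A.alg)

instance : MonoidalCategory (RelCat T Q) :=
  MonoidalCategory.ofTensorHom
    (id_tensorHom_id := fun A B =>
      (graph_tensor_graph (Q := Q) (𝟙 _) A.alg.isHom_id (𝟙 _) B.alg.isHom_id).trans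
        (graph_congr (id_tensorHom_id _ _) _ (A.alg.prod B.alg).isHom_id))
    (tensorHom_comp_tensorHom := fun {A B C A' B' C'} R R' S S' =>
      tensor_comp (A := A.alg) (B := B.alg) (C := C.alg) (A' := A'.alg) (B' := B'.alg)
        (C' := C'.alg) R S R' S')
    (associator_naturality := fun {A B C A' B' C'} R S U =>
      assoc_naturality (A := A.alg) (B := B.alg) (C := C.alg) (A' := A'.alg) (B' := B'.alg)
        (C' := C'.alg) R S U)
    (leftUnitor_naturality := fun {A B} R =>
      leftUnitor_naturality (A := A.alg) (B := B.alg) R)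
    (rightUnitor_naturality := fun {A B} R =>
      rightUnitor_naturality (A := A.alg) (B := B.alg) R)
    (pentagon := fun A B C D => AlgRel.pentagon A.alg B.alg C.alg D.alg)
    (triangle := fun A B => AlgRel.triangle A.alg B.alg)

/-- The braiding is the graph of the exchange morphism. -/
def braid (A B : RelCat T Q) : A ⊗ B ≅ B ⊗ A :=
  graphIso ⟨A.alg.prod B.alg⟩ ⟨B.alg.prod A.alg⟩
    ⟨A.alg.swap B.alg, B.alg.swap A.alg, by ext <;> simp, by ext <;> simp⟩
    (Alg.isHom_swap A.alg B.alg) (Alg.isHom_swap B.alg A.alg)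

instance : SymmetricCategory (RelCat T Q) where
  braiding := braid
  braiding_naturality_left {A A'} R B :=
    swap_naturality (A := A.alg) (A' := A'.alg) (B := B.alg) (B' := B.alg) R (AlgRel.id B.alg)
  braiding_naturality_right A B B' R :=
    swap_naturality (A := A.alg) (A' := A.alg) (B := B.alg) (B' := B'.alg) (AlgRel.id A.alg) R
  hexagon_forward A B C := AlgRel.hexagon_forward A.alg B.alg C.alg
  hexagon_reverse A B C := AlgRel.hexagon_reverse A.alg B.alg C.alg
  symmetry A B := (braid A B).hom_inv_id

end RelCat

/-- An algebraic `Q`-span from `A` to `B`: a span `A ← X → B` with a characteristic morphism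
`χ : X ⟶ Q` such that, for every operation `σ` and all `x₁, …, xₙ` in `X`, there exists `y` with
`f(y) = σ(f(x₁),…,f(xₙ))`, `g(y) = σ(g(x₁),…,g(xₙ))` and `χ(x₁) ⊗ ⋯ ⊗ χ(xₙ) ≤ χ(y)`. The existence
of `y` is understood in the internal language, i.e. `y` exists after restriction along an
epimorphism `e`. -/
structure AlgSpan (Q : CommQuantale E) (A B : Alg E T) where
  /-- The apex. -/
  apex : E
  /-- The left leg. -/
  left : apex ⟶ A.carrier
  /-- The right leg. -/
  right : apex ⟶ B.carrier
  /-- The characteristic morphism. -/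
  chi : apex ⟶ Q.carrier
  alg : ∀ (σ : T.Op) {I : E} (x : Fin (T.arity σ) → (I ⟶ apex)),
    ∃ (J : E) (e : J ⟶ I) (_ : Epi e) (y : J ⟶ apex),
      y ≫ left = e ≫ A.app σ (fun j => x j ≫ left) ∧
      y ≫ right = e ≫ B.app σ (fun j => x j ≫ right) ∧
      e ≫ (∏ j, x j ≫ chi) ≤ y ≫ chi

namespace AlgSpan

variable {Q}
variable {A B C D A' B' C' : Alg E T}

/-- Isomorphism of `Q`-spans. -/
def Equiv (s t : AlgSpan Q A B) : Prop :=
  ∃ φ : s.apex ≅ t.apex, φ.hom ≫ t.left = s.left ∧ φ.hom ≫ t.right = s.right ∧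
    φ.hom ≫ t.chi = s.chi

instance setoid (A B : Alg E T) : Setoid (AlgSpan Q A B) where
  r := Equiv
  iseqv :=
    { refl := fun s => ⟨Iso.refl _, by simp⟩
      symm := by
        rintro s t ⟨φ, h1, h2, h3⟩
        exact ⟨φ.symm, by simp [← h1], by simp [← h2], by simp [← h3]⟩
      trans := by
        rintro s t u ⟨φ, h1, h2, h3⟩ ⟨ψ, k1, k2, k3⟩
        exact ⟨φ ≪≫ ψ, by simp [k1, h1], by simp [k2, h2], by simp [k3, h3]⟩ }

/-- The preorder on `Q`-spans. -/
def Le (s t : AlgSpan Q A B) : Prop :=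
  ∃ (m : s.apex ⟶ t.apex) (_ : Mono m), s.left = m ≫ t.left ∧ s.right = m ≫ t.right ∧
    s.chi ≤ m ≫ t.chi

theorem Equiv.le {s t : AlgSpan Q A B} (h : s ≈ t) : s.Le t := by
  obtain ⟨φ, h1, h2, h3⟩ := h
  exact ⟨φ.hom, inferInstance, h1.symm, h2.symm, h3.ge⟩

theorem Le.trans {s t u : AlgSpan Q A B} (h : s.Le t) (k : t.Le u) : s.Le u := by
  obtain ⟨m, _, h1, h2, h3⟩ := h
  obtain ⟨n, _, k1, k2, k3⟩ := k
  exact ⟨m ≫ n, inferInstance, by simp [h1, k1], by simp [h2, k2],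
    h3.trans (by simpa using CommQuantale.comp_mono m k3)⟩

/-- The graph `(A, 1, f, χ_k)` of a homomorphism. -/
abbrev graph (f : A.carrier ⟶ B.carrier) (hf : A.IsHom B f) : AlgSpan Q A B where
  apex := A.carrier
  left := 𝟙 _
  right := f
  chi := 1
  alg σ I x := ⟨I, 𝟙 I, inferInstance, A.app σ x, by simp, by simp [hf.app], by simp⟩

/-- The identity span `(A, 1, 1, χ_k)`. -/
abbrev id (A : Alg E T) : AlgSpan Q A A := graph (𝟙 _) A.isHom_id

/-- The composite of two spans, by pullback; `(x, y)` has characteristic value `χ(x) ⊗ ξ(y)`. -/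
abbrev comp (s : AlgSpan Q A B) (t : AlgSpan Q B C) : AlgSpan Q A C where
  apex := pullback s.right t.left
  left := pullback.fst _ _ ≫ s.left
  right := pullback.snd _ _ ≫ t.right
  chi := (pullback.fst _ _ ≫ s.chi) * (pullback.snd _ _ ≫ t.chi)
  alg σ I x := by
    obtain ⟨J, e, _, y, h1, h2, h3⟩ := s.alg σ (fun j => x j ≫ pullback.fst _ _)
    obtain ⟨J', e', _, y', h1', h2', h3'⟩ := t.alg σ (fun j => x j ≫ pullback.snd _ _)
    obtain ⟨K, d, _, z, hz⟩ := exists_cover e e'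
    refine ⟨K, d ≫ e', inferInstance, pullback.lift (z ≫ y) (d ≫ y') ?_, ?_, ?_, ?_⟩
    · rw [Category.assoc, Category.assoc, h2, h1', reassoc_of% hz]
      simp only [Category.assoc, pullback.condition]
    · rw [pullback.lift_fst_assoc, Category.assoc, h1, reassoc_of% hz]
      simp
    · rw [pullback.lift_snd_assoc, Category.assoc, h2']
      simp
    · have k := CommQuantale.comp_mono z h3
      have k' := CommQuantale.comp_mono d h3'
      rw [← Category.assoc, hz] at k
      simp only [CommQuantale.comp_mul, Finset.prod_mul_distrib, pullback.lift_fst_assoc,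
        pullback.lift_snd_assoc] at k k' ⊢
      simp only [Category.assoc] at k k' ⊢
      exact mul_le_mul' k k'

/-- The tensor product of two spans. -/
abbrev tensor (s : AlgSpan Q A B) (t : AlgSpan Q A' B') : AlgSpan Q (A.prod A') (B.prod B') where
  apex := s.apex ⊗ t.apex
  left := s.left ⊗ₘ t.left
  right := s.right ⊗ₘ t.right
  chi := (fst _ _ ≫ s.chi) * (snd _ _ ≫ t.chi)
  alg σ I x := by
    obtain ⟨J, e, _, y, h1, h2, h3⟩ := s.alg σ (fun j => x j ≫ fst _ _)
    obtain ⟨J', e', _, y', h1', h2', h3'⟩ := t.alg σ (fun j => x j ≫ snd _ _)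
    obtain ⟨K, d, _, z, hz⟩ := exists_cover e e'
    refine ⟨K, d ≫ e', inferInstance, lift (z ≫ y) (d ≫ y'), ?_, ?_, ?_⟩
    · rw [lift_map, Category.assoc, Category.assoc, h1, h1', reassoc_of% hz, Alg.prod_app]
      simp [comp_lift]
    · rw [lift_map, Category.assoc, Category.assoc, h2, h2', reassoc_of% hz, Alg.prod_app]
      simp [comp_lift]
    · have k := CommQuantale.comp_mono z h3
      have k' := CommQuantale.comp_mono d h3'
      rw [← Category.assoc, hz] at k
      simp only [CommQuantale.comp_mul, Finset.prod_mul_distrib, lift_fst_assoc,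
        lift_snd_assoc] at k k' ⊢
      simp only [Category.assoc] at k k' ⊢
      exact mul_le_mul' k k'

theorem comp_le {s s' : AlgSpan Q A B} {t t' : AlgSpan Q B C} (h : s.Le s') (k : t.Le t') :
    (s.comp t).Le (s'.comp t') := by
  obtain ⟨m, _, h1, h2, h3⟩ := h
  obtain ⟨n, _, k1, k2, k3⟩ := k
  refine ⟨pullback.lift (pullback.fst _ _ ≫ m) (pullback.snd _ _ ≫ n) ?_, ⟨fun a b hab => ?_⟩,
    ?_, ?_, ?_⟩
  · rw [Category.assoc, Category.assoc, ← h2, ← k1, pullback.condition]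
  · have e1 := congrArg (· ≫ pullback.fst _ _) hab
    have e2 := congrArg (· ≫ pullback.snd _ _) hab
    simp only [Category.assoc, pullback.lift_fst, pullback.lift_snd] at e1 e2
    refine pullback.hom_ext ?_ ?_
    · rw [← cancel_mono m]; simpa using e1
    · rw [← cancel_mono n]; simpa using e2
  · simp only [pullback.lift_fst_assoc, h1, Category.assoc]
  · simp only [pullback.lift_snd_assoc, k2, Category.assoc]
  · simp only [CommQuantale.comp_mul, pullback.lift_fst_assoc, pullback.lift_snd_assoc]
    simp only [Category.assoc]
    exact mul_le_mul' (CommQuantale.comp_mono _ h3) (CommQuantale.comp_mono _ k3)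

theorem comp_equiv {s s' : AlgSpan Q A B} {t t' : AlgSpan Q B C} (h : s ≈ s') (k : t ≈ t') :
    s.comp t ≈ s'.comp t' := by
  obtain ⟨m, h1, h2, h3⟩ := h
  obtain ⟨n, k1, k2, k3⟩ := k
  refine ⟨⟨pullback.lift (pullback.fst _ _ ≫ m.hom) (pullback.snd _ _ ≫ n.hom) ?_,
    pullback.lift (pullback.fst _ _ ≫ m.inv) (pullback.snd _ _ ≫ n.inv) ?_, ?_, ?_⟩, ?_, ?_, ?_⟩
  · simp only [Category.assoc, h2, k1, pullback.condition]
  · simp only [Category.assoc, ← h2, ← k1, Iso.inv_hom_id_assoc, pullback.condition]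
  · refine pullback.hom_ext ?_ ?_ <;> simp only [Category.assoc, pullback.lift_fst,
      pullback.lift_snd, pullback.lift_fst_assoc, pullback.lift_snd_assoc, Iso.hom_inv_id,
      Category.comp_id, Category.id_comp]
  · refine pullback.hom_ext ?_ ?_ <;> simp only [Category.assoc, pullback.lift_fst,
      pullback.lift_snd, pullback.lift_fst_assoc, pullback.lift_snd_assoc, Iso.inv_hom_id,
      Category.comp_id, Category.id_comp]
  · simp only [pullback.lift_fst_assoc, Category.assoc, h1]
  · simp only [pullback.lift_snd_assoc, Category.assoc, k2]
  · simp only [CommQuantale.comp_mul, pullback.lift_fst_assoc, pullback.lift_snd_assoc,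
      Category.assoc, h3, k3]

theorem tensor_le {s s' : AlgSpan Q A B} {t t' : AlgSpan Q A' B'} (h : s.Le s') (k : t.Le t') :
    (s.tensor t).Le (s'.tensor t') := by
  obtain ⟨m, _, h1, h2, h3⟩ := h
  obtain ⟨n, _, k1, k2, k3⟩ := k
  refine ⟨m ⊗ₘ n, ⟨fun a b hab => ?_⟩, ?_, ?_, ?_⟩
  · have e1 := congrArg (· ≫ fst _ _) hab
    have e2 := congrArg (· ≫ snd _ _) hab
    simp only [Category.assoc, tensorHom_fst, tensorHom_snd] at e1 e2
    apply CartesianMonoidalCategory.hom_ext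
    · rw [← cancel_mono m]; simpa using e1
    · rw [← cancel_mono n]; simpa using e2
  · simp [tensor, h1, k1]
  · simp [tensor, h2, k2]
  · simp only [tensor, CommQuantale.comp_mul, tensorHom_fst_assoc, tensorHom_snd_assoc]
    exact mul_le_mul' (CommQuantale.comp_mono _ h3) (CommQuantale.comp_mono _ k3)

theorem tensor_equiv {s s' : AlgSpan Q A B} {t t' : AlgSpan Q A' B'} (h : s ≈ s') (k : t ≈ t') :
    s.tensor t ≈ s'.tensor t' := by
  obtain ⟨m, h1, h2, h3⟩ := h
  obtain ⟨n, k1, k2, k3⟩ := k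
  refine ⟨m ⊗ᵢ n, ?_, ?_, ?_⟩
  · simp [tensor, h1, k1]
  · simp [tensor, h2, k2]
  · simp [tensor, CommQuantale.comp_mul, h3, k3]

theorem graph_comp_equiv (f : A.carrier ⟶ B.carrier) (hf : A.IsHom B f) [IsIso f]
    (t : AlgSpan Q B C) (u : AlgSpan Q A C) (φ : u.apex ≅ t.apex)
    (h1 : φ.hom ≫ t.left = u.left ≫ f) (h2 : φ.hom ≫ t.right = u.right)
    (h3 : φ.hom ≫ t.chi = u.chi) : u ≈ (graph f hf).comp t := by
  refine Setoid.symm ?_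
  refine ⟨asIso (pullback.snd f t.left) ≪≫ φ.symm, ?_, ?_, ?_⟩
  · have : φ.inv ≫ u.left = t.left ≫ inv f := by
      rw [Iso.inv_comp_eq, ← Category.assoc, h1]; simp
    simp [comp, graph, this, ← pullback.condition_assoc]
  · simp [comp, graph, ← h2]
  · simp [comp, graph, ← h3]

theorem comp_graph_equiv (s : AlgSpan Q A B) (g : B.carrier ⟶ C.carrier) (hg : B.IsHom C g)
    (u : AlgSpan Q A C) (φ : s.apex ≅ u.apex)
    (h1 : φ.hom ≫ u.left = s.left) (h2 : φ.hom ≫ u.right = s.right ≫ g)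
    (h3 : φ.hom ≫ u.chi = s.chi) : s.comp (graph g hg) ≈ u := by
  refine ⟨asIso (pullback.fst s.right (𝟙 _)) ≪≫ φ, ?_, ?_, ?_⟩
  · simp [comp, graph, h1]
  · simp [comp, graph, h2, pullback.condition_assoc]
  · simp [comp, graph, h3]

theorem comp_assoc (s : AlgSpan Q A B) (t : AlgSpan Q B C) (u : AlgSpan Q C D) :
    (s.comp t).comp u ≈ s.comp (t.comp u) := by
  refine ⟨pullbackAssoc s.right t.left t.right u.left, ?_, ?_, ?_⟩
  · simp [comp]
  · simp [comp]
  · simp [comp, CommQuantale.comp_mul, mul_assoc]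

theorem tensor_comp (s : AlgSpan Q A B) (t : AlgSpan Q B C) (s' : AlgSpan Q A' B')
    (t' : AlgSpan Q B' C') :
    (s.tensor s').comp (t.tensor t') ≈ (s.comp t).tensor (s'.comp t') := by
  have c := pullback.condition (f := s.right ⊗ₘ s'.right) (g := t.left ⊗ₘ t'.left)
  have c1 := congrArg (· ≫ fst _ _) c
  have c2 := congrArg (· ≫ snd _ _) c
  simp only [Category.assoc, tensorHom_fst, tensorHom_snd] at c1 c2
  refine ⟨⟨lift
      (pullback.lift (pullback.fst _ _ ≫ fst _ _) (pullback.snd _ _ ≫ fst _ _) (by simpa using c1))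
      (pullback.lift (pullback.fst _ _ ≫ snd _ _) (pullback.snd _ _ ≫ snd _ _) (by simpa using c2)),
    pullback.lift (pullback.fst _ _ ⊗ₘ pullback.fst _ _) (pullback.snd _ _ ⊗ₘ pullback.snd _ _)
      (by simp only [tensorHom_comp_tensorHom, pullback.condition]),
    ?_, ?_⟩, ?_, ?_, ?_⟩
  · refine pullback.hom_ext ?_ ?_ <;> apply CartesianMonoidalCategory.hom_ext <;>
    simp only [Category.assoc, pullback.lift_fst, pullback.lift_snd, tensorHom_fst, tensorHom_snd,
      lift_fst_assoc, lift_snd_assoc, Category.id_comp]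
  · apply CartesianMonoidalCategory.hom_ext <;> refine pullback.hom_ext ?_ ?_ <;>
    simp only [Category.assoc, pullback.lift_fst, pullback.lift_snd, pullback.lift_fst_assoc,
      pullback.lift_snd_assoc, tensorHom_fst, tensorHom_snd, lift_fst, lift_snd, Category.id_comp]
  · apply CartesianMonoidalCategory.hom_ext <;> simp only [Category.assoc, tensorHom_fst,
      tensorHom_snd, lift_fst_assoc, lift_snd_assoc, pullback.lift_fst_assoc]
  · apply CartesianMonoidalCategory.hom_ext <;> simp only [Category.assoc, tensorHom_fst,
      tensorHom_snd, lift_fst_assoc, lift_snd_assoc, pullback.lift_snd_assoc]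
  · simp only [Category.assoc, CommQuantale.comp_mul, pullback.lift_fst_assoc,
      pullback.lift_snd_assoc, lift_fst_assoc, lift_snd_assoc]
    exact mul_mul_mul_comm _ _ _ _

theorem graph_tensor_graph (f : A.carrier ⟶ B.carrier) (hf : A.IsHom B f)
    (g : A'.carrier ⟶ B'.carrier) (hg : A'.IsHom B' g) :
    (graph f hf).tensor (graph g hg) ≈ graph (Q := Q) (f ⊗ₘ g) (hf.tensor hg) :=
  ⟨Iso.refl _, by simp [graph, tensor], by simp [graph, tensor],
    by simp [graph, tensor]⟩

end AlgSpan
/-- Isomorphism classes of algebraic `Q`-spans. -/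
def SpanClass (Q : CommQuantale E) (A B : Alg E T) : Type (max u v) :=
  Quotient (AlgSpan.setoid (Q := Q) A B)

namespace SpanClass

variable {Q}
variable {A B C D A' B' C' : Alg E T}

/-- The class of a span. -/
def mk (s : AlgSpan Q A B) : SpanClass Q A B := Quotient.mk _ s

theorem sound {s t : AlgSpan Q A B} (h : s ≈ t) : mk s = mk t := Quotient.sound h

/-- The order on classes of spans, computed on representatives. -/
instance preorder (A B : Alg E T) : Preorder (SpanClass Q A B) where
  le := Quotient.lift₂ AlgSpan.Le fun _ _ _ _ h k => propext
    ⟨fun l => ((Setoid.symm h).le.trans l).trans k.le,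
      fun l => (h.le.trans l).trans (Setoid.symm k).le⟩
  le_refl := by rintro ⟨s⟩; exact AlgSpan.Equiv.le (Setoid.refl s)
  le_trans := by rintro ⟨s⟩ ⟨t⟩ ⟨u⟩ h k; exact AlgSpan.Le.trans h k

/-- The class of the graph of a homomorphism. -/
def graph (f : A.carrier ⟶ B.carrier) (hf : A.IsHom B f) : SpanClass Q A B := mk (.graph f hf)

/-- The identity, i.e. the class of the identity span. -/
def id (A : Alg E T) : SpanClass Q A A := graph (𝟙 _) A.isHom_id

/-- Composition of classes of spans. -/
def comp : SpanClass Q A B → SpanClass Q B C → SpanClass Q A C :=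
  Quotient.map₂ AlgSpan.comp fun _ _ h _ _ k => AlgSpan.comp_equiv h k

/-- Tensor product of classes of spans. -/
def tensor : SpanClass Q A B → SpanClass Q A' B' → SpanClass Q (A.prod A') (B.prod B') :=
  Quotient.map₂ AlgSpan.tensor fun _ _ h _ _ k => AlgSpan.tensor_equiv h k

theorem comp_le {s s' : SpanClass Q A B} {t t' : SpanClass Q B C} (h : s ≤ s') (k : t ≤ t') :
    s.comp t ≤ s'.comp t' := by
  obtain ⟨s⟩ := s; obtain ⟨s'⟩ := s'; obtain ⟨t⟩ := t; obtain ⟨t'⟩ := t'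
  exact AlgSpan.comp_le h k

theorem tensor_le {s s' : SpanClass Q A B} {t t' : SpanClass Q A' B'} (h : s ≤ s') (k : t ≤ t') :
    s.tensor t ≤ s'.tensor t' := by
  obtain ⟨s⟩ := s; obtain ⟨s'⟩ := s'; obtain ⟨t⟩ := t; obtain ⟨t'⟩ := t'
  exact AlgSpan.tensor_le h k

theorem graph_congr {f g : A.carrier ⟶ B.carrier} (h : f = g) (hf : A.IsHom B f)
    (hg : A.IsHom B g) : graph (Q := Q) f hf = graph g hg := by
  subst h; rfl

theorem comp_assoc (s : SpanClass Q A B) (t : SpanClass Q B C) (u : SpanClass Q C D) :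
    (s.comp t).comp u = s.comp (t.comp u) := by
  obtain ⟨s⟩ := s; obtain ⟨t⟩ := t; obtain ⟨u⟩ := u
  exact sound (AlgSpan.comp_assoc s t u)

theorem id_comp (s : SpanClass Q A B) : (id A).comp s = s := by
  obtain ⟨s⟩ := s
  exact sound (Setoid.symm (AlgSpan.graph_comp_equiv (𝟙 _) A.isHom_id s s (Iso.refl _)
    (by simp) (by simp) (by simp)))

theorem comp_id (s : SpanClass Q A B) : s.comp (id B) = s := by
  obtain ⟨s⟩ := s
  exact sound (AlgSpan.comp_graph_equiv s (𝟙 _) B.isHom_id s (Iso.refl _)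
    (by simp) (by simp) (by simp))

theorem tensor_comp (s : SpanClass Q A B) (t : SpanClass Q B C) (s' : SpanClass Q A' B')
    (t' : SpanClass Q B' C') :
    (s.tensor s').comp (t.tensor t') = (s.comp t).tensor (s'.comp t') := by
  obtain ⟨s⟩ := s; obtain ⟨t⟩ := t; obtain ⟨s'⟩ := s'; obtain ⟨t'⟩ := t'
  exact sound (AlgSpan.tensor_comp s t s' t')

theorem graph_tensor_graph (f : A.carrier ⟶ B.carrier) (hf : A.IsHom B f)
    (g : A'.carrier ⟶ B'.carrier) (hg : A'.IsHom B' g) :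
    (graph f hf).tensor (graph g hg) = graph (Q := Q) (f ⊗ₘ g) (hf.tensor hg) :=
  sound (AlgSpan.graph_tensor_graph f hf g hg)

theorem graph_comp_graph (f : A.carrier ⟶ B.carrier) (hf : A.IsHom B f)
    (g : B.carrier ⟶ C.carrier) (hg : B.IsHom C g) :
    (graph f hf).comp (graph g hg) = graph (Q := Q) (f ≫ g) (hf.comp hg) :=
  sound (AlgSpan.comp_graph_equiv _ g hg _ (Iso.refl _) (by simp) (by simp) (by simp))

theorem naturality (s : AlgSpan Q A B) (t : AlgSpan Q C D) (f : A.carrier ⟶ C.carrier)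
    (hf : A.IsHom C f) [IsIso f] (g : B.carrier ⟶ D.carrier) (hg : B.IsHom D g)
    (φ : s.apex ≅ t.apex) (h1 : φ.hom ≫ t.left = s.left ≫ f)
    (h2 : φ.hom ≫ t.right = s.right ≫ g) (h3 : φ.hom ≫ t.chi = s.chi) :
    (mk s).comp (graph g hg) = (graph f hf).comp (mk t) := by
  let u : AlgSpan Q A D :=
    { apex := s.apex
      left := s.left
      right := s.right ≫ g
      chi := s.chi
      alg := fun σ I x => by
        obtain ⟨J, e, he, y, k1, k2, k3⟩ := s.alg σ x
        exact ⟨J, e, he, y, k1, by simp [reassoc_of% k2, hg.app], k3⟩ }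
  exact sound (Setoid.trans
    (AlgSpan.comp_graph_equiv s g hg u (Iso.refl _) (by simp [u]) (by simp [u]) (by simp [u]))
    (AlgSpan.graph_comp_equiv f hf t u φ h1 h2 h3))

theorem assoc_naturality (s : SpanClass Q A A') (t : SpanClass Q B B') (u : SpanClass Q C C') :
    ((s.tensor t).tensor u).comp (graph _ (Alg.isHom_assoc A' B' C')) =
      (graph _ (Alg.isHom_assoc A B C)).comp (s.tensor (t.tensor u)) := by
  obtain ⟨s⟩ := s; obtain ⟨t⟩ := t; obtain ⟨u⟩ := u
  exact naturality ((s.tensor t).tensor u) (s.tensor (t.tensor u)) _ (Alg.isHom_assoc A B C) _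
    (Alg.isHom_assoc A' B' C') (α_ s.apex t.apex u.apex) (by simp) (by simp)
    (by simp [CommQuantale.comp_mul, mul_assoc])

theorem leftUnitor_naturality (s : SpanClass Q A B) :
    ((id (Alg.terminal E T)).tensor s).comp (graph _ (Alg.isHom_leftUnitor B)) =
      (graph _ (Alg.isHom_leftUnitor A)).comp s := by
  obtain ⟨s⟩ := s
  exact naturality ((AlgSpan.id _).tensor s) s _ (Alg.isHom_leftUnitor A) _
    (Alg.isHom_leftUnitor B) (λ_ s.apex) (by simp) (by simp) (by simp [leftUnitor_hom])

theorem rightUnitor_naturality (s : SpanClass Q A B) :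
    (s.tensor (id (Alg.terminal E T))).comp (graph _ (Alg.isHom_rightUnitor B)) =
      (graph _ (Alg.isHom_rightUnitor A)).comp s := by
  obtain ⟨s⟩ := s
  exact naturality (s.tensor (AlgSpan.id _)) s _ (Alg.isHom_rightUnitor A) _
    (Alg.isHom_rightUnitor B) (ρ_ s.apex) (by simp) (by simp) (by simp [rightUnitor_hom])

theorem swap_naturality (s : SpanClass Q A A') (t : SpanClass Q B B') :
    (s.tensor t).comp (graph _ (Alg.isHom_swap A' B')) =
      (graph _ (Alg.isHom_swap A B)).comp (t.tensor s) := by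
  obtain ⟨s⟩ := s; obtain ⟨t⟩ := t
  have : IsIso (A.swap B) := ⟨B.swap A, by ext <;> simp, by ext <;> simp⟩
  refine naturality (s.tensor t) (t.tensor s) _ (Alg.isHom_swap A B) _
    (Alg.isHom_swap A' B') ⟨lift (snd _ _) (fst _ _), lift (snd _ _) (fst _ _),
      by ext <;> simp, by ext <;> simp⟩ (by ext <;> simp) (by ext <;> simp) ?_
  simp only [CommQuantale.comp_mul, lift_fst_assoc, lift_snd_assoc]
  exact mul_comm _ _

theorem pentagon (A B C D : Alg E T) :
    ((graph _ (Alg.isHom_assoc A B C)).tensor (SpanClass.id D)).comp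
      ((graph _ (Alg.isHom_assoc A (B.prod C) D)).comp
        ((SpanClass.id A).tensor (graph _ (Alg.isHom_assoc B C D)))) =
      (graph (Q := Q) _ (Alg.isHom_assoc (A.prod B) C D)).comp
        (graph _ (Alg.isHom_assoc A B (C.prod D))) := by
  simp only [SpanClass.id, graph_tensor_graph, graph_comp_graph]
  apply graph_congr
  simp

theorem triangle (A B : Alg E T) :
    (graph _ (Alg.isHom_assoc A (Alg.terminal E T) B)).comp
      ((SpanClass.id A).tensor (graph _ (Alg.isHom_leftUnitor B))) =
      (graph (Q := Q) _ (Alg.isHom_rightUnitor A)).tensor (SpanClass.id B) := by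
  simp only [SpanClass.id, graph_tensor_graph, graph_comp_graph]
  apply graph_congr
  simp

theorem hexagon_forward (A B C : Alg E T) :
    (graph _ (Alg.isHom_assoc A B C)).comp
      ((graph _ (Alg.isHom_swap A (B.prod C))).comp (graph _ (Alg.isHom_assoc B C A))) =
    ((graph (Q := Q) _ (Alg.isHom_swap A B)).tensor (SpanClass.id C)).comp
      ((graph _ (Alg.isHom_assoc B A C)).comp
        ((SpanClass.id B).tensor (graph _ (Alg.isHom_swap A C)))) := by
  simp only [SpanClass.id, graph_tensor_graph, graph_comp_graph]
  apply graph_congr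
  ext <;> simp

theorem hexagon_reverse (A B C : Alg E T) :
    (graph _ (Alg.isHom_assoc_inv A B C)).comp
      ((graph _ (Alg.isHom_swap (A.prod B) C)).comp (graph _ (Alg.isHom_assoc_inv C A B))) =
    ((SpanClass.id A).tensor (graph (Q := Q) _ (Alg.isHom_swap B C))).comp
      ((graph _ (Alg.isHom_assoc_inv A C B)).comp
        ((graph _ (Alg.isHom_swap A C)).tensor (SpanClass.id B))) := by
  simp only [SpanClass.id, graph_tensor_graph, graph_comp_graph]
  apply graph_congr
  ext <;> simp

end SpanClass

variable (T) in
/-- The category `Span_{(Σ,E)}(Q)`: objects are `(Σ, E)`-algebras, morphisms are isomorphism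
classes of algebraic `Q`-spans. -/
structure SpanCat (Q : CommQuantale E) where
  /-- The underlying algebra. -/
  alg : Alg E T

namespace SpanCat

variable {Q}

open SpanClass

instance : Category (SpanCat T Q) where
  Hom A B := SpanClass Q A.alg B.alg
  id A := SpanClass.id A.alg
  comp s t := s.comp t
  id_comp s := s.id_comp
  comp_id s := s.comp_id
  assoc s t u := s.comp_assoc t u

variable {A B C D : SpanCat T Q}

/-- The morphism represented by an algebraic `Q`-span. -/
def ofSpan (s : AlgSpan Q A.alg B.alg) : A ⟶ B := SpanClass.mk s

/-- The isomorphism given by the graph of an isomorphism of algebras. -/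
def graphIso (A B : SpanCat T Q) (f : A.alg.carrier ≅ B.alg.carrier) (hf : A.alg.IsHom B.alg f.hom)
    (hg : B.alg.IsHom A.alg f.inv) : A ≅ B where
  hom := graph f.hom hf
  inv := graph f.inv hg
  hom_inv_id := (graph_comp_graph _ hf _ hg).trans (graph_congr f.hom_inv_id _ A.alg.isHom_id)
  inv_hom_id := (graph_comp_graph _ hg _ hf).trans (graph_congr f.inv_hom_id _ B.alg.isHom_id)

/-- The tensor of objects is the product of algebras, the unit is the terminal algebra, and the
coherence isomorphisms are the graphs of those of the topos. -/
instance : MonoidalCategoryStruct (SpanCat T Q) where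
  tensorObj A B := ⟨A.alg.prod B.alg⟩
  tensorHom R S := SpanClass.tensor R S
  whiskerLeft A _ _ R := SpanClass.tensor (SpanClass.id A.alg) R
  whiskerRight R A := SpanClass.tensor R (SpanClass.id A.alg)
  tensorUnit := ⟨Alg.terminal E T⟩
  associator A B C := graphIso ⟨(A.alg.prod B.alg).prod C.alg⟩ ⟨A.alg.prod (B.alg.prod C.alg)⟩
    (α_ _ _ _) (Alg.isHom_assoc A.alg B.alg C.alg) (Alg.isHom_assoc_inv A.alg B.alg C.alg)
  leftUnitor A := graphIso ⟨(Alg.terminal E T).prod A.alg⟩ A (λ_ _)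
    (Alg.isHom_leftUnitor A.alg) (Alg.isHom_leftUnitor_inv A.alg)
  rightUnitor A := graphIso ⟨A.alg.prod (Alg.terminal E T)⟩ A (ρ_ _)
    (Alg.isHom_rightUnitor A.alg) (Alg.isHom_rightUnitor_inv A.alg)

instance : MonoidalCategory (SpanCat T Q) :=
  MonoidalCategory.ofTensorHom
    (id_tensorHom_id := fun A B =>
      (graph_tensor_graph (Q := Q) (𝟙 _) A.alg.isHom_id (𝟙 _) B.alg.isHom_id).trans
        (graph_congr (id_tensorHom_id _ _) _ (A.alg.prod B.alg).isHom_id))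
    (tensorHom_comp_tensorHom := fun {A B C A' B' C'} R R' S S' =>
      tensor_comp (A := A.alg) (B := B.alg) (C := C.alg) (A' := A'.alg) (B' := B'.alg)
        (C' := C'.alg) R S R' S')
    (associator_naturality := fun {A B C A' B' C'} R S U =>
      assoc_naturality (A := A.alg) (B := B.alg) (C := C.alg) (A' := A'.alg) (B' := B'.alg)
        (C' := C'.alg) R S U)
    (leftUnitor_naturality := fun {A B} R =>
      leftUnitor_naturality (A := A.alg) (B := B.alg) R)
    (rightUnitor_naturality := fun {A B} R =>
      rightUnitor_naturality (A := A.alg) (B := B.alg) R)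
    (pentagon := fun A B C D => SpanClass.pentagon A.alg B.alg C.alg D.alg)
    (triangle := fun A B => SpanClass.triangle A.alg B.alg)

/-- The braiding is the graph of the exchange morphism. -/
def braid (A B : SpanCat T Q) : A ⊗ B ≅ B ⊗ A :=
  graphIso ⟨A.alg.prod B.alg⟩ ⟨B.alg.prod A.alg⟩
    ⟨A.alg.swap B.alg, B.alg.swap A.alg, by ext <;> simp, by ext <;> simp⟩
    (Alg.isHom_swap A.alg B.alg) (Alg.isHom_swap B.alg A.alg)

instance : SymmetricCategory (SpanCat T Q) where
  braiding := braid
  braiding_naturality_left {A A'} R B :=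
    swap_naturality (A := A.alg) (A' := A'.alg) (B := B.alg) (B' := B.alg) R (SpanClass.id B.alg)
  braiding_naturality_right A B B' R :=
    swap_naturality (A := A.alg) (A' := A.alg) (B := B.alg) (B' := B'.alg) (SpanClass.id A.alg) R
  hexagon_forward A B C := SpanClass.hexagon_forward A.alg B.alg C.alg
  hexagon_reverse A B C := SpanClass.hexagon_reverse A.alg B.alg C.alg
  symmetry A B := (braid A B).hom_inv_id

end SpanCat

end Topos

section Ordered

/-- A preordered monoidal category: the sets of morphisms are preordered, and composition and
tensor product are monotone, i.e. a `Preord`-enriched monoidal category. -/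
class PreorderedMonoidal (C : Type u) [Category.{v} C] [MonoidalCategory C] where
  homPreorder : ∀ X Y : C, Preorder (X ⟶ Y)
  comp_le : ∀ {X Y Z : C} {f f' : X ⟶ Y} {g g' : Y ⟶ Z}, f ≤ f' → g ≤ g' → f ≫ g ≤ f' ≫ g'
  tensor_le : ∀ {X Y X' Y' : C} {f f' : X ⟶ Y} {g g' : X' ⟶ Y'},
    f ≤ f' → g ≤ g' → (f ⊗ₘ g) ≤ (f' ⊗ₘ g')

attribute [reducible, instance] PreorderedMonoidal.homPreorder

/-- A (lax) monoidal functor is strict if its structure morphisms are identities. -/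
structure IsStrictMonoidal {C D : Type*} [Category* C] [MonoidalCategory C] [Category* D]
    [MonoidalCategory D] (F : C ⥤ D) [F.LaxMonoidal] : Prop where
  unit : ∃ h : 𝟙_ D = F.obj (𝟙_ C), Functor.LaxMonoidal.ε F = eqToHom h
  tensor : ∀ X Y : C, ∃ h : F.obj X ⊗ F.obj Y = F.obj (X ⊗ Y),
    Functor.LaxMonoidal.μ F X Y = eqToHom h

variable {E : Type u} [Category.{v} E] [CartesianMonoidalCategory E] [HasFiniteLimits E]
  [MonoidalClosed E] [HasSubobjectClassifier E] {T : Variety.{w}} {Q : CommQuantale E}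

/-- Relations are ordered pointwise. -/
instance AlgRel.partialOrder (A B : Alg E T) : PartialOrder (AlgRel Q A B) where
  le R S := R.rel ≤ S.rel
  le_refl R := le_refl R.rel
  le_trans R S U h k := le_trans (α := A.carrier ⊗ B.carrier ⟶ Q.carrier) h k
  le_antisymm R S h k := AlgRel.ext (le_antisymm h k)

theorem AlgRel.elem_le {A B : Alg E T} {R S : AlgRel Q A B} (h : R ≤ S) {I : E}
    (a : I ⟶ A.carrier) (b : I ⟶ B.carrier) : lift a b ≫ R.rel ≤ lift a b ≫ S.rel :=
  CommQuantale.comp_mono _ h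

theorem AlgRel.comp_le {A B C : Alg E T} {R R' : AlgRel Q A B} {S S' : AlgRel Q B C} (h : R ≤ R')
    (k : S ≤ S') : R.comp S ≤ R'.comp S' :=
  AlgRel.le_of_elem fun _ _ _ => AlgRel.compRel_le _ _ _ fun _ _ _ => by
    rw [AlgRel.comp_elem]
    exact (mul_le_mul' (AlgRel.elem_le h _ _) (AlgRel.elem_le k _ _)).trans
      (AlgRel.le_compRel _ _ _)

theorem AlgRel.tensor_le {A B A' B' : Alg E T} {R S : AlgRel Q A B} {R' S' : AlgRel Q A' B'}
    (h : R ≤ S) (k : R' ≤ S') : R.tensor R' ≤ S.tensor S' :=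
  mul_le_mul' (AlgRel.elem_le h _ _) (AlgRel.elem_le k _ _)

instance : PreorderedMonoidal (RelCat T Q) where
  homPreorder A B := (AlgRel.partialOrder A.alg B.alg).toPreorder
  comp_le h k := AlgRel.comp_le h k
  tensor_le h k := AlgRel.tensor_le h k

instance : PreorderedMonoidal (SpanCat T Q) where
  homPreorder A B := SpanClass.preorder A.alg B.alg
  comp_le h k := SpanClass.comp_le h k
  tensor_le h k := SpanClass.tensor_le h k

end Ordered

end QuantaleTopos

end

/-!
The functor `V` sends a `Q`-span `(X, f, g, χ)` to `(a, b) ↦ ⋁ {χ(x) | f(x) = a, g(x) = b}`, a join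
indexed by the fibres of `(f, g) : X ⟶ A × B`. Everything is checked on generalized elements, by
the universal property of joins (`CommQuantale.join_le_iff`) and distributivity of `⊗` over joins.

* The relation is algebraic: a product of joins is bounded as soon as all products
  `χ(x₁) ⊗ ⋯ ⊗ χ(xₙ)` are. The element which a `Q`-span provides above such a product exists only
  after restriction along an epimorphism, which suffices, since epimorphisms reflect the order of
  `Q`.
* Composition is preserved (`AlgSpan.toRel_comp`): for spans `s = (X, f, g, χ)` and
  `t = (Y, h, l, ξ)`, distributivity shows that both `V(t ∘ s)(a, c)` and `(V t ∘ V s)(a, c)` are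
  the join of the values `χ(x) ⊗ ξ(y)` for `f(x) = a`, `g(x) = h(y)`,
  `l(y) = c`. The tensor product is treated in the same way (`AlgSpan.toRel_tensor`).
* The relational graph of a homomorphism is by definition the image of its graph as a span. As
  identities, coherence isomorphisms and braidings are graphs on both sides, `V` preserves them,
  and identity morphisms serve as monoidal structure on `V`.
* A morphism of spans `m` with `χ₁(x) ≤ χ₂(m(x))` maps fibres to fibres, so that the joins grow.
-/

namespace QuantaleTopos

variable {E : Type u} [Category.{v} E] [CartesianMonoidalCategory E] [HasFiniteLimits E]
  [MonoidalClosed E] [HasSubobjectClassifier E] {T : Variety.{w}} {Q : CommQuantale E}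

namespace AlgSpan

variable {A B C A' B' : Alg E T}

/-- The algebraic `Q`-relation `(a, b) ↦ ⋁ {χ(x) | f(x) = a, g(x) = b}` of an algebraic `Q`-span
`(X, f, g, χ)`. -/
noncomputable def toRel (s : AlgSpan Q A B) : AlgRel Q A B where
  rel := Q.join (lift s.left s.right) s.chi
  alg σ I a b := by
    refine CommQuantale.prod_join_le _ _ fun L g x hx => ?_
    have h1 : ∀ j, x j ≫ s.left = g ≫ a j := fun j => by
      simpa using congrArg (· ≫ fst _ _) (hx j)
    have h2 : ∀ j, x j ≫ s.right = g ≫ b j := fun j => by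
      simpa using congrArg (· ≫ snd _ _) (hx j)
    obtain ⟨J, e, _, y, k1, k2, k3⟩ := s.alg σ x
    refine CommQuantale.le_of_epi e (k3.trans ?_)
    rw [AlgRel.comp_elem, AlgRel.comp_elem]
    refine CommQuantale.le_join' y ?_
    simp only [comp_lift, k1, k2, h1, h2, Alg.comp_app]

/-- Distributivity: `c ⊗ V(X, f, g, χ)(a, b) ≤ r` if and only if `c ⊗ χ(x) ≤ r` for all `x` above
`(a, b)`. -/
theorem toRel_elem_le_iff (s : AlgSpan Q A B) {I : E} (c : I ⟶ Q.carrier) (a : I ⟶ A.carrier)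
    (b : I ⟶ B.carrier) (r : I ⟶ Q.carrier) :
    c * (lift a b ≫ s.toRel.rel) ≤ r ↔ ∀ (L : E) (g : L ⟶ I) (x : L ⟶ s.apex),
      x ≫ s.left = g ≫ a → x ≫ s.right = g ≫ b → (g ≫ c) * (x ≫ s.chi) ≤ g ≫ r := by
  refine (CommQuantale.mul_join_le_iff c (lift a b) r).trans
    ⟨fun h L g x h1 h2 => h L g x (by simp only [comp_lift, h1, h2]), fun h L g x hx => ?_⟩
  exact h L g x (by simpa using congrArg (· ≫ fst _ _) hx)
    (by simpa using congrArg (· ≫ snd _ _) hx)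

theorem toRel_elem_le (s : AlgSpan Q A B) {I : E} (a : I ⟶ A.carrier) (b : I ⟶ B.carrier)
    (r : I ⟶ Q.carrier) (h : ∀ (L : E) (g : L ⟶ I) (x : L ⟶ s.apex),
      x ≫ s.left = g ≫ a → x ≫ s.right = g ≫ b → x ≫ s.chi ≤ g ≫ r) :
    lift a b ≫ s.toRel.rel ≤ r := by
  rw [← one_mul (lift a b ≫ _), toRel_elem_le_iff]
  intro L g x h1 h2
  rw [CommQuantale.comp_one, one_mul]
  exact h L g x h1 h2

theorem chi_le_toRel (s : AlgSpan Q A B) {L : E} (x : L ⟶ s.apex) {a : L ⟶ A.carrier}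
    {b : L ⟶ B.carrier} (h1 : x ≫ s.left = a) (h2 : x ≫ s.right = b) :
    x ≫ s.chi ≤ lift a b ≫ s.toRel.rel :=
  CommQuantale.le_join' x (by rw [comp_lift, h1, h2])

theorem toRel_mono {s t : AlgSpan Q A B} (h : s.Le t) : s.toRel ≤ t.toRel := by
  obtain ⟨m, _, h1, h2, h3⟩ := h
  refine AlgRel.le_of_elem fun I a b => toRel_elem_le _ _ _ _ fun L g x k1 k2 => ?_
  rw [AlgRel.comp_elem]
  refine (CommQuantale.comp_mono x h3).trans ?_
  rw [← Category.assoc]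
  exact chi_le_toRel t (x ≫ m) (by rw [Category.assoc, ← h1, k1])
    (by rw [Category.assoc, ← h2, k2])

theorem toRel_comp (s : AlgSpan Q A B) (t : AlgSpan Q B C) :
    (s.comp t).toRel = s.toRel.comp t.toRel := by
  ext1
  apply le_antisymm
  · refine AlgRel.le_of_elem fun I a c => toRel_elem_le _ _ _ _ fun L g x h1 h2 => ?_
    rw [AlgRel.comp_elem, CommQuantale.comp_mul, ← Category.assoc, ← Category.assoc]
    exact (mul_le_mul' (chi_le_toRel s _ (by simpa using h1) rfl)
      (chi_le_toRel t _ (by simp only [Category.assoc, pullback.condition])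
        (by simpa using h2))).trans (AlgRel.le_compRel _ _ _)
  · refine AlgRel.le_of_elem fun I a c => AlgRel.compRel_le _ _ _ fun L g b => ?_
    -- Distributivity, applied to both factors, reduces the claim to a pair `(x, y)` of elements of
    -- the two apices lying over the same `b`.
    rw [toRel_elem_le_iff]
    intro M h y hy1 hy2
    rw [mul_comm, AlgRel.comp_elem, toRel_elem_le_iff]
    intro N k x hx1 hx2
    have := chi_le_toRel (s.comp t) (pullback.lift x (k ≫ y) (by rw [hx2, Category.assoc, hy1]))
      (a := k ≫ h ≫ g ≫ a) (b := k ≫ h ≫ g ≫ c) (by rw [pullback.lift_fst_assoc, hx1])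
      (by rw [pullback.lift_snd_assoc, Category.assoc, hy2])
    rw [CommQuantale.comp_mul, pullback.lift_fst_assoc, pullback.lift_snd_assoc] at this
    simpa only [AlgRel.comp_elem, mul_comm, Category.assoc] using this

theorem toRel_tensor (s : AlgSpan Q A B) (t : AlgSpan Q A' B') :
    (s.tensor t).toRel = s.toRel.tensor t.toRel := by
  ext1
  apply le_antisymm
  · refine AlgRel.le_of_elem fun I a b => toRel_elem_le _ _ _ _ fun L g x h1 h2 => ?_
    rw [AlgRel.comp_elem, AlgRel.tensor_elem, CommQuantale.comp_mul, ← h1, ← h2, ← Category.assoc,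
      ← Category.assoc]
    exact mul_le_mul' (chi_le_toRel s _ (by simp) (by simp)) (chi_le_toRel t _ (by simp) (by simp))
  · refine AlgRel.le_of_elem fun I a b => ?_
    rw [AlgRel.tensor_elem, toRel_elem_le_iff]
    intro M h y hy1 hy2
    rw [mul_comm, AlgRel.comp_elem, toRel_elem_le_iff]
    intro N k x hx1 hx2
    have := chi_le_toRel (s.tensor t) (lift x (k ≫ y)) (a := k ≫ h ≫ a) (b := k ≫ h ≫ b)
      (by ext <;> simp [hx1, hy1]) (by ext <;> simp [hx2, hy2])
    rw [CommQuantale.comp_mul, lift_fst_assoc, lift_snd_assoc] at this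
    simpa only [AlgRel.comp_elem, mul_comm, Category.assoc] using this

end AlgSpan

/-- The algebraic `Q`-relation of an isomorphism class of algebraic `Q`-spans. -/
noncomputable def SpanClass.toRel {A B : Alg E T} : SpanClass Q A B → AlgRel Q A B :=
  Quotient.lift AlgSpan.toRel fun _ _ h =>
    le_antisymm (AlgSpan.toRel_mono h.le) (AlgSpan.toRel_mono (Setoid.symm h).le)

theorem SpanClass.toRel_comp {A B C : Alg E T} (s : SpanClass Q A B) (t : SpanClass Q B C) :
    (s.comp t).toRel = s.toRel.comp t.toRel := by
  obtain ⟨s⟩ := s; obtain ⟨t⟩ := t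
  exact AlgSpan.toRel_comp s t

theorem SpanClass.toRel_tensor {A B A' B' : Alg E T} (s : SpanClass Q A B)
    (t : SpanClass Q A' B') : (s.tensor t).toRel = s.toRel.tensor t.toRel := by
  obtain ⟨s⟩ := s; obtain ⟨t⟩ := t
  exact AlgSpan.toRel_tensor s t

theorem SpanClass.toRel_mono {A B : Alg E T} {s t : SpanClass Q A B} (h : s ≤ t) :
    s.toRel ≤ t.toRel := by
  obtain ⟨s⟩ := s; obtain ⟨t⟩ := t
  exact AlgSpan.toRel_mono h

namespace SpanCat

variable (T Q) in
/-- The functor `V`, the identity on objects, which sends the class of a `Q`-span to its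
`Q`-relation. -/
noncomputable def toRelCat : SpanCat T Q ⥤ RelCat T Q where
  obj A := ⟨A.alg⟩
  map s := SpanClass.toRel s
  map_id _ := rfl
  map_comp s t := SpanClass.toRel_comp s t

/-- The monoidal structure of `V`, consisting of identities. The coherence axioms hold because `V`
preserves graphs. -/
noncomputable def toRelCatCoreMonoidal : (toRelCat T Q).CoreMonoidal where
  εIso := Iso.refl (𝟙_ (RelCat T Q))
  μIso A B := Iso.refl ((toRelCat T Q).obj A ⊗ (toRelCat T Q).obj B)
  μIso_hom_natural_left {A A'} s B := by
    have h : (toRelCat T Q).map s ▷ (toRelCat T Q).obj B = (toRelCat T Q).map (s ▷ B) :=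
      (SpanClass.toRel_tensor (A := A.alg) (B := A'.alg) s (SpanClass.id B.alg)).symm
    exact (Category.comp_id _).trans (h.trans (Category.id_comp _).symm)
  μIso_hom_natural_right {B B'} A s := by
    have h : (toRelCat T Q).obj A ◁ (toRelCat T Q).map s = (toRelCat T Q).map (A ◁ s) :=
      (SpanClass.toRel_tensor (A' := B.alg) (B' := B'.alg) (SpanClass.id A.alg) s).symm
    exact (Category.comp_id _).trans (h.trans (Category.id_comp _).symm)
  -- `V` sends each coherence isomorphism to its counterpart by definition, so that the axioms
  -- concern identities and coherence isomorphisms of `RelCat T Q` only.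
  associativity A B C := by
    have key (X Y Z : RelCat T Q) : 𝟙 (X ⊗ Y) ▷ Z ≫ 𝟙 ((X ⊗ Y) ⊗ Z) ≫ (α_ X Y Z).hom =
        (α_ X Y Z).hom ≫ X ◁ 𝟙 (Y ⊗ Z) ≫ 𝟙 (X ⊗ Y ⊗ Z) := by simp
    exact key ⟨A.alg⟩ ⟨B.alg⟩ ⟨C.alg⟩
  left_unitality A := by
    have key (X : RelCat T Q) :
        (λ_ X).hom = 𝟙 (𝟙_ (RelCat T Q)) ▷ X ≫ 𝟙 (𝟙_ _ ⊗ X) ≫ (λ_ X).hom := by simp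
    exact key ⟨A.alg⟩
  right_unitality A := by
    have key (X : RelCat T Q) :
        (ρ_ X).hom = X ◁ 𝟙 (𝟙_ (RelCat T Q)) ≫ 𝟙 (X ⊗ 𝟙_ _) ≫ (ρ_ X).hom := by simp
    exact key ⟨A.alg⟩

noncomputable instance : (toRelCat T Q).Monoidal := toRelCatCoreMonoidal.toMonoidal

noncomputable instance : (toRelCat T Q).Braided where
  braided A B := by
    have key (X Y : RelCat T Q) : 𝟙 (X ⊗ Y) ≫ (β_ X Y).hom = (β_ X Y).hom ≫ 𝟙 (Y ⊗ X) := by simp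
    exact key ⟨A.alg⟩ ⟨B.alg⟩

theorem isStrictMonoidal_toRelCat : IsStrictMonoidal (toRelCat T Q) where
  unit := ⟨rfl, rfl⟩
  tensor A B :=
    ⟨rfl, (eqToHom_refl ((toRelCat T Q).obj A ⊗ (toRelCat T Q).obj B) rfl).symm⟩

end SpanCat

end QuantaleTopos

theorem mainTheorem4 {E : Type u} [Category.{v} E] [CartesianMonoidalCategory E]
    [HasFiniteLimits E] [MonoidalClosed E] [HasSubobjectClassifier E]
    (T : QuantaleTopos.Variety.{w}) (Q : QuantaleTopos.CommQuantale E) :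
    ∃ (V : QuantaleTopos.SpanCat T Q ⥤ QuantaleTopos.RelCat T Q) (_ : V.Braided)
      (hobj : ∀ A : QuantaleTopos.SpanCat T Q, V.obj A = ⟨A.alg⟩),
      QuantaleTopos.IsStrictMonoidal V ∧
      (∀ (A B : QuantaleTopos.SpanCat T Q) (s t : A ⟶ B), s ≤ t → V.map s ≤ V.map t) ∧
      ∀ (A B : QuantaleTopos.SpanCat T Q) (s : QuantaleTopos.AlgSpan Q A.alg B.alg),
        QuantaleTopos.RelCat.rel (A := ⟨A.alg⟩) (B := ⟨B.alg⟩)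
            (eqToHom (hobj A).symm ≫ V.map (QuantaleTopos.SpanCat.ofSpan s) ≫ eqToHom (hobj B)) =
          Q.join (lift s.left s.right) s.chi := by
  refine ⟨QuantaleTopos.SpanCat.toRelCat T Q, inferInstance, fun _ => rfl,
    QuantaleTopos.SpanCat.isStrictMonoidal_toRelCat,
    fun _ _ _ _ h => QuantaleTopos.SpanClass.toRel_mono h, fun A B s => ?_⟩
  -- Both transports along `V.obj A = ⟨A.alg⟩` are identities.
  exact congrArg QuantaleTopos.RelCat.rel
    ((Category.id_comp _).trans (Category.comp_id
      ((QuantaleTopos.SpanCat.toRelCat T Q).map (QuantaleTopos.SpanCat.ofSpan s))))
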